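/- **Setting.** Let $$\varphi=\forall x\,\alpha\ \wedge\bigwedge_{1\le h\le l}\forall x\forall y\,(e_h(x,y)\to(\beta_h\vee x\approx y))\ \wedge\bigwedge_{1\le i\le m}\forall x\,\exists_{=C_i}y\,(f_i(x,y)\wedge x\not\approx y)$$ be a formula over a finite signature of unary and binary predicates, where $l,m\ge 1$, every $C_i$ is a positive integer, $e_h,f_i$ are binary predicates of the signature, $\alpha$ is a quantifier- and equality-free formula in the variable $x$ only, and the $\beta_h$ are quantifier- and equality-free formulas in $x,y$. (This is the normal form for the guarded two-variable fragment with counting quantifiers.) Put $\mathbf C=(C_1,\dots,C_m)$, $C=\max_i C_i$, and let $\Sigma$ be the signature of $\varphi$ together with $\lceil\log_2((mC)^2+1)\rceil$ new unary predicates. A structure has a non-empty, finite or infinite, domain. *Types.* A 1-type (2-type) is a maximal consistent set of equality-free literals over $\Sigma$ in the variable $x$ (in the variables $x,y$). For a 2-type $\tau$, $\tau^{-1}$ is the result of transposing $x$ and $y$; $\mathrm{tp}_1(\tau)$ is the 1-type included in $\tau$, and $\mathrm{tp}_2(\tau)=\mathrm{tp}_1(\tau^{-1})$. $\tau$ is a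 message-type if $f_i(x,y)\in\tau$ for some $i$; a message-type $\tau$ is invertible if $\tau^{-1}$ is a message-type, and otherwise non-invertible; $\tau$ is silent if neither $\tau$ nor $\tau^{-1}$ is a message-type. $\mathbf C_\tau\in\{0,1\}^m$ has $i$-th entry $1$ iff $f_i(x,y)\in\tau$. $\tau$ is forbidden if $$\alpha(x)\wedge\alpha(y)\wedge\bigwedge_h(e_h(x,y)\to\beta_h(x,y))\wedge\bigwedge_h(e_h(y,x)\to\beta_h(y,x))\wedge\bigwedge\tau$$ is unsatisfiable. *Bit-strings.* Fix an enumeration $\Pi$ of all 1-types, of length $P=2^p$, and for each 1-type $\pi$ an enumeration $M_\pi$ of the 2-types $\tau$ such that $\mathrm{tp}_1(\tau)=\pi$ and $\tau^{-1}$ is not a message-type, with the non-invertible message-types first and the silent 2-types after them; its length $Q=2^q$ does not depend on $\pi$. For a bit-string $s$ with $|s|\le p$ let $\Pi_\epsilon=\Pi$ and let $\Pi_{s0},\Pi_{s1}$ be the left and right halves of $\Pi_s$; define $M_{\pi,t}$ for $|t|\le q$ in the same way. For $|t|=q$ let $\mu_{\pi,t}$ be the only member of $M_{\pi,t}$. Let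 $\Lambda_{\pi,s}$ be the set of the invertible message-types $\lambda$ with $\mathrm{tp}_1(\lambda)=\pi$ and $\mathrm{tp}_2(\lambda)\in\Pi_s$. *Constraints.* Let $\pi$ range over 1-types, $\lambda$ over invertible message-types, $\mathbf u,\mathbf v,\mathbf w$ over vectors in $\mathbb N^m$ that are componentwise $\le\mathbf C$, and $s,t$ over bit-strings. The set $V$ of variables consists of distinct symbols $x_\lambda$; $y_{\pi,s,\mathbf u}$ ($|s|\le p$); $z_{\pi,t,\mathbf u}$ ($|t|\le q$); $\hat y_{\pi,s,\mathbf v,\mathbf w}$ ($|s|<p$); $\hat z_{\pi,t,\mathbf v,\mathbf w}$ ($|t|<q$). The set $\mathcal E$ consists of the following constraints (an empty sum is $0$). 1. For $|s|<p$, $|t|<q$: - $z_{\pi,\epsilon,\mathbf u}=y_{\pi,\epsilon,\mathbf C-\mathbf u}$; - $y_{\pi,s,\mathbf u}=\sum\{\hat y_{\pi,s,\mathbf v',\mathbf w'}\mid\mathbf v'+\mathbf w'=\mathbf u\}$ and $z_{\pi,t,\mathbf u}=\sum\{\hat z_{\pi,t,\mathbf v',\mathbf w'}\mid\mathbf v'+\mathbf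 w'=\mathbf u\}$; - $y_{\pi,s0,\mathbf v}=\sum\{\hat y_{\pi,s,\mathbf v,\mathbf w'}\mid\mathbf v+\mathbf w'\le\mathbf C\}$ and $y_{\pi,s1,\mathbf w}=\sum\{\hat y_{\pi,s,\mathbf v',\mathbf w}\mid\mathbf v'+\mathbf w\le\mathbf C\}$; - $z_{\pi,t0,\mathbf v}=\sum\{\hat z_{\pi,t,\mathbf v,\mathbf w'}\mid\mathbf v+\mathbf w'\le\mathbf C\}$ and $z_{\pi,t1,\mathbf w}=\sum\{\hat z_{\pi,t,\mathbf v',\mathbf w}\mid\mathbf v'+\mathbf w\le\mathbf C\}$; - $1\le\sum\{y_{\pi',\epsilon,\mathbf u'}\mid\pi'\text{ a 1-type},\ \mathbf u'\le\mathbf C\}$. 2. For $|s|=p$, $|t|=q$ and $\mathbf 0\ne\mathbf u\le\mathbf C$: - $y_{\pi,s,\mathbf u}=\sum\{x_{\lambda'}\mid\lambda'\in\Lambda_{\pi,s},\ \mathbf C_{\lambda'}=\mathbf u\}$; - $z_{\pi,t,\mathbf u}=0$ whenever $\mathbf u$ is not a scalar multiple of $\mathbf C_{\mu_{\pi,t}}$;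 - $x_{\lambda^{-1}}=x_\lambda$; - $x_\lambda=0$ whenever $\mathrm{tp}_1(\lambda)=\mathrm{tp}_2(\lambda)$; - $x_\lambda=0$ whenever $\lambda$ is forbidden; - $z_{\pi,t,\mathbf u}=0$ whenever $\mu_{\pi,t}$ is forbidden. 3. For $|t|=q$ and $\mathbf 0\ne\mathbf u\le\mathbf C$: - $z_{\pi,t,\mathbf u}>0\ \Rightarrow\ \sum\{y_{\pi',\epsilon,\mathbf u'}\mid\pi'=\mathrm{tp}_2(\mu_{\pi,t}),\ \mathbf u'\le\mathbf C\}\ge 3mC$. Let $\mathbb N^*=\mathbb N\cup\{\aleph_0\}$ with the usual extended order and arithmetic. A solution of $\mathcal E$ over $D\subseteq\mathbb N^*$ is a map $\theta:V\to D$ under which all the constraints are true. Translate each constraint into propositional Horn clauses over letters $X_v$ ($v\in V$), with $X_v$ standing for $v=0$: a constraint $u_1+\dots+u_n=v$ becomes $X_{u_1}\wedge\dots\wedge X_{u_n}\to X_v$ together with $X_v\to X_{u_j}$ for all $j$; a constraint $u_1+\dots+u_n\ge1$ becomes $X_{u_1}\wedge\dots\wedge X_{u_n}\to\bot$; a constraint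 $v=0$ becomes $X_v$; and a constraint $v>0\Rightarrow u_1+\dots+u_n\ge 3mC$ becomes $X_{u_1}\wedge\dots\wedge X_{u_n}\to X_v$. **Statement.** For every such $\varphi$ and every choice of the enumerations: (a) $\varphi$ is satisfiable (in a finite or infinite structure) if and only if $\mathcal E$ has a solution over $\mathbb N^*$. (b) $\mathcal E$ has a solution over $\mathbb N^*$ if and only if it has a solution over $\{0,\aleph_0\}$. (c) A map $\theta:V\to\{0,\aleph_0\}$ is a solution of $\mathcal E$ if and only if the truth-value assignment under which $X_v$ is true exactly when $\theta(v)=0$ satisfies all the Horn clauses obtained from $\mathcal E$; hence $\mathcal E$ has a solution over $\{0,\aleph_0\}$ if and only if this set of Horn clauses is satisfiable. -/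

import Mathlib

universe w

namespace GC2

/- ## Two-variable logic with counting quantifiers -/

/-- A finite signature of unary and binary predicates. -/
structure Signature where
  Un : Type
  Bin : Type
  [fintypeUn : Fintype Un]
  [fintypeBin : Fintype Bin]

attribute [instance] Signature.fintypeUn Signature.fintypeBin

/-- The signature `σ` together with `k` new unary predicates. -/
def Signature.extend (σ : Signature) (k : ℕ) : Signature where
  Un := σ.Un ⊕ Fin k
  Bin := σ.Bin

/-- The two individual variables. -/
inductive FOVar
  | x
  | y

instance : Fintype FOVar := ⟨⟨{FOVar.x, FOVar.y}, by simp⟩, fun v => by cases v <;> simp⟩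

/-- The other variable. -/
def FOVar.swap : FOVar → FOVar
  | .x => .y
  | .y => .x

/-- Equality-free atomic formulas over `σ` with variables from `W`: `p(v)` and `r(v,v')`. -/
abbrev Atom (σ : Signature) (W : Type) : Type := (σ.Un × W) ⊕ (σ.Bin × W × W)

/-- Renaming of the variables of an atom. -/
def Atom.rename {σ : Signature} {W W' : Type} (g : W → W') : Atom σ W → Atom σ W'
  | .inl (p, v) => .inl (p, g v)
  | .inr (r, v, v') => .inr (r, g v, g v')

/-- The atom `r(v,v')`. -/
def Atom.bin {σ : Signature} {W : Type} (r : σ.Bin) (v v' : W) : Atom σ W := .inr (r, v, v')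

/-- Interpretations of `σ` with domain `A`. -/
structure Struct (σ : Signature) (A : Type w) where
  un : σ.Un → A → Prop
  bin : σ.Bin → A → A → Prop

/-- Forgetting the new unary predicates. -/
def Struct.reduct {σ : Signature} {k : ℕ} {A : Type w} (S : Struct (σ.extend k) A) :
    Struct σ A where
  un p := S.un (Sum.inl p)
  bin r := S.bin r

/-- Truth of an atom under an assignment of elements to variables. -/
def Atom.Holds {σ : Signature} {W : Type} {A : Type w} (S : Struct σ A) (θ : W → A) :
    Atom σ W → Prop
  | .inl (p, v) => S.un p (θ v)
  | .inr (r, v, v') => S.bin r (θ v) (θ v')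

/-- First-order formulas in the variables `x`, `y`, with equality and counting quantifiers. -/
inductive Formula (σ : Signature)
  | atom (a : Atom σ FOVar)
  | eq (v v' : FOVar)
  | top
  | neg (ψ : Formula σ)
  | and (ψ χ : Formula σ)
  | or (ψ χ : Formula σ)
  | imp (ψ χ : Formula σ)
  | all (v : FOVar) (ψ : Formula σ)
  | ex (v : FOVar) (ψ : Formula σ)
  | exLe (C : ℕ) (v : FOVar) (ψ : Formula σ)
  | exGe (C : ℕ) (v : FOVar) (ψ : Formula σ)
  | exEq (C : ℕ) (v : FOVar) (ψ : Formula σ)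

/-- Change of an assignment at one variable. -/
def update {A : Type w} (θ : FOVar → A) : FOVar → A → FOVar → A
  | .x, a, .x => a
  | .x, _, .y => θ .y
  | .y, _, .x => θ .x
  | .y, a, .y => a

/-- The assignment `x ↦ a`, `y ↦ b`. -/
def assign {A : Type w} (a b : A) : FOVar → A
  | .x => a
  | .y => b

namespace Formula

variable {σ : Signature}

/-- Truth of a formula in a structure under an assignment. -/
def Eval {A : Type w} (S : Struct σ A) : Formula σ → (FOVar → A) → Prop
  | atom a, θ => a.Holds S θ
  | eq v v', θ => θ v = θ v'
  | top, _ => True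
  | neg ψ, θ => ¬ Eval S ψ θ
  | and ψ χ, θ => Eval S ψ θ ∧ Eval S χ θ
  | or ψ χ, θ => Eval S ψ θ ∨ Eval S χ θ
  | imp ψ χ, θ => Eval S ψ θ → Eval S χ θ
  | all v ψ, θ => ∀ a, Eval S ψ (update θ v a)
  | ex v ψ, θ => ∃ a, Eval S ψ (update θ v a)
  | exLe C v ψ, θ => {a | Eval S ψ (update θ v a)}.encard ≤ C
  | exGe C v ψ, θ => (C : ℕ∞) ≤ {a | Eval S ψ (update θ v a)}.encard
  | exEq C v ψ, θ => {a | Eval S ψ (update θ v a)}.encard = C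

/-- Satisfiability over arbitrary (finite or infinite) structures. The domain is non-empty, because
it carries an assignment. -/
def Satisfiable (ψ : Formula σ) : Prop :=
  ∃ (A : Type w) (S : Struct σ A) (θ : FOVar → A), ψ.Eval S θ

/-- Quantifier-free, not involving equality, and all variables in `W`. -/
def IsBoolean (W : Set FOVar) : Formula σ → Prop
  | atom (.inl (_, v)) => v ∈ W
  | atom (.inr (_, v, v')) => v ∈ W ∧ v' ∈ W
  | top => True
  | neg ψ => IsBoolean W ψ
  | and ψ χ => IsBoolean W ψ ∧ IsBoolean W χ
  | or ψ χ => IsBoolean W ψ ∧ IsBoolean W χ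
  | imp ψ χ => IsBoolean W ψ ∧ IsBoolean W χ
  | _ => False

/-- Conjunction of a list of formulas. -/
def conj : List (Formula σ) → Formula σ
  | [] => top
  | ψ :: L => and ψ (conj L)

end Formula

/- ## Formulas in normal form -/

/-- The data of a formula in normal form. -/
structure NormalForm (σ : Signature) where
  /-- the universal part, in the variable `x` -/
  α : Formula σ
  l : ℕ
  m : ℕ
  /-- the guards -/
  e : Fin l → σ.Bin
  β : Fin l → Formula σ
  /-- the counting predicates -/
  f : Fin m → σ.Bin
  C : Fin m → ℕ
  l_pos : 0 < l
  m_pos : 0 < m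
  α_boolean : α.IsBoolean {FOVar.x}
  β_boolean : ∀ h, (β h).IsBoolean Set.univ
  C_pos : ∀ i, 0 < C i

namespace NormalForm

variable {σ : Signature} (φ : NormalForm σ)

/-- The formula
`∀x α ∧ ⋀ₕ ∀x∀y (eₕ(x,y) → (βₕ ∨ x ≈ y)) ∧ ⋀ᵢ ∀x ∃_{=Cᵢ}y (fᵢ(x,y) ∧ x ≉ y)`. -/
def toFormula : Formula σ :=
  .and (.all .x φ.α) <|
  .and
    (.conj <| List.ofFn fun h : Fin φ.l =>
      .all .x <| .all .y <| .imp (.atom (.bin (φ.e h) .x .y)) (.or (φ.β h) (.eq .x .y)))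
    (.conj <| List.ofFn fun i : Fin φ.m =>
      .all .x <| .exEq (φ.C i) .y <|
        .and (.atom (.bin (φ.f i) .x .y)) (.neg (.eq .x .y)))

/-- `C = max Cᵢ`. -/
def maxC : ℕ := Finset.univ.sup φ.C

/-- The signature `Σ`: `σ` and `⌈log₂((mC)² + 1)⌉` new unary predicates. -/
def sig : Signature := σ.extend (Nat.clog 2 ((φ.m * φ.maxC) ^ 2 + 1))

/- ## Types

A 1-type (2-type) over `Σ` is a maximal consistent set of equality-free literals in `x`
(in `x` and `y`). Such a set contains exactly one of `γ`, `¬γ` for each atom `γ`, and every choice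
is consistent, so it is given by the set of the atoms that occur in it positively. -/

/-- 1-types (the one element of `Unit` stands for the variable `x`). -/
abbrev OneType : Type := Set (Atom φ.sig Unit)

/-- 2-types. -/
abbrev TwoType : Type := Set (Atom φ.sig FOVar)

variable {φ}

/-- `τ⁻¹`: the result of transposing `x` and `y` in `τ`. -/
def inv (τ : φ.TwoType) : φ.TwoType := {a | a.rename FOVar.swap ∈ τ}

/-- The 1-type included in `τ`. -/
def tp₁ (τ : φ.TwoType) : φ.OneType := {a | a.rename (fun _ => FOVar.x) ∈ τ}

/-- `tp₂(τ) = tp₁(τ⁻¹)`. -/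
def tp₂ (τ : φ.TwoType) : φ.OneType := tp₁ (inv τ)

/-- `fᵢ(x,y) ∈ τ`. -/
def Sends (τ : φ.TwoType) (i : Fin φ.m) : Prop :=
  (Atom.bin (σ := φ.sig) (φ.f i) FOVar.x FOVar.y) ∈ τ

/-- Message-types. -/
def IsMessage (τ : φ.TwoType) : Prop := ∃ i, Sends τ i

/-- Invertible message-types. -/
def IsInvertible (τ : φ.TwoType) : Prop := IsMessage τ ∧ IsMessage (inv τ)

/-- Non-invertible message-types. -/
def IsNonInvertible (τ : φ.TwoType) : Prop := IsMessage τ ∧ ¬ IsMessage (inv τ)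

/-- Silent 2-types. -/
def IsSilent (τ : φ.TwoType) : Prop := ¬ IsMessage τ ∧ ¬ IsMessage (inv τ)

open Classical in
/-- The vector `C_τ`: its `i`-th entry is `1` if `fᵢ(x,y) ∈ τ`, and `0` otherwise. -/
noncomputable def vecOf (τ : φ.TwoType) : Fin φ.m → ℕ := fun i => if Sends τ i then 1 else 0

/-- `τ` is forbidden: the formula
`α(x) ∧ α(y) ∧ ⋀ₕ (eₕ(x,y) → βₕ(x,y)) ∧ ⋀ₕ (eₕ(y,x) → βₕ(y,x)) ∧ ⋀τ` is unsatisfiable. -/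
def IsForbidden (τ : φ.TwoType) : Prop :=
  ¬ ∃ (A : Type) (S : Struct φ.sig A) (a b : A),
    φ.α.Eval S.reduct (assign a b) ∧ φ.α.Eval S.reduct (assign b a) ∧
    (∀ h, S.bin (φ.e h) a b → (φ.β h).Eval S.reduct (assign a b)) ∧
    (∀ h, S.bin (φ.e h) b a → (φ.β h).Eval S.reduct (assign b a)) ∧
    (∀ γ : Atom φ.sig FOVar, γ ∈ τ → γ.Holds S (assign a b)) ∧
    (∀ γ : Atom φ.sig FOVar, γ ∉ τ → ¬ γ.Holds S (assign a b))

end NormalForm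

/- ## Enumerations and bit-strings -/

/-- The left half (bit `0 = false`) or the right half (bit `1 = true`) of a list. -/
def half {γ : Type} (L : List γ) : Bool → List γ
  | false => L.take (L.length / 2)
  | true => L.drop (L.length / 2)

/-- The sub-list `L_s`: `L_ε = L`, and `L_{s0}`, `L_{s1}` are the left and right half of `L_s`. -/
def piece {γ : Type} (L : List γ) (s : List Bool) : List γ := s.foldl half L

open NormalForm in
/-- A choice of enumerations without repetition: `Pi` of all the 1-types and, for each 1-type `π`,
`nonInv π` of the non-invertible message-types and `silent π` of the silent 2-types `τ` with
`tp₁(τ) = π`. -/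
structure Enumeration {σ : Signature} (φ : NormalForm σ) where
  Pi : List φ.OneType
  Pi_nodup : Pi.Nodup
  mem_Pi : ∀ π, π ∈ Pi
  nonInv : φ.OneType → List φ.TwoType
  nonInv_nodup : ∀ π, (nonInv π).Nodup
  mem_nonInv : ∀ π τ, τ ∈ nonInv π ↔ tp₁ τ = π ∧ IsNonInvertible τ
  silent : φ.OneType → List φ.TwoType
  silent_nodup : ∀ π, (silent π).Nodup
  mem_silent : ∀ π τ, τ ∈ silent π ↔ tp₁ τ = π ∧ IsSilent τ

namespace Enumeration

open NormalForm

variable {σ : Signature} {φ : NormalForm σ} (E : Enumeration φ)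

/-- `M_π`: the non-invertible message-types, followed by the silent 2-types. -/
def M (π : φ.OneType) : List φ.TwoType := E.nonInv π ++ E.silent π

/-- `p = log₂ P`, where `P` is the number of 1-types. -/
def p : ℕ := Nat.log 2 E.Pi.length

/-- `q = log₂ Q`, where `Q` is the length of `M_π`; it does not depend on `π` (`length_M`). -/
def q : ℕ := Nat.log 2 (E.M ∅).length

/-- `Λ_{π,s}`: the invertible message-types `τ` with `tp₁(τ) = π` and `tp₂(τ) ∈ Π_s`. -/
def Lam (π : φ.OneType) (s : List Bool) : Set φ.TwoType :=
  {τ | IsInvertible τ ∧ tp₁ τ = π ∧ tp₂ τ ∈ piece E.Pi s}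

theorem length_Pi : E.Pi.length = 2 ^ E.p := by
  classical
  have h : E.Pi.length = Fintype.card φ.OneType := by
    rw [← List.toFinset_card_of_nodup E.Pi_nodup, ← Finset.card_univ]
    congr 1
    ext π
    simp [E.mem_Pi π]
  rw [p, h, Fintype.card_set, Nat.log_pow (by norm_num)]

theorem nodup_M (π : φ.OneType) : (E.M π).Nodup := by
  refine List.Nodup.append (E.nonInv_nodup π) (E.silent_nodup π) ?_
  intro τ h₁ h₂
  exact ((E.mem_silent π τ).1 h₂).2.1 ((E.mem_nonInv π τ).1 h₁).2.1

theorem mem_M (π : φ.OneType) (τ : φ.TwoType) :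
    τ ∈ E.M π ↔ tp₁ τ = π ∧ ¬ IsMessage (inv τ) := by
  simp only [M, List.mem_append, E.mem_nonInv, E.mem_silent, IsNonInvertible, IsSilent]
  tauto

theorem rename_injective {σ : Signature} (v : FOVar) :
    Function.Injective (Atom.rename (σ := σ) (fun _ : Unit => v)) := by
  rintro (⟨p, a⟩ | ⟨r, a, b⟩) (⟨p', a'⟩ | ⟨r', a', b'⟩) h <;> simp_all [Atom.rename]

/-- The atoms that a member of `M_π` may contain or omit freely. -/
def freeAtoms (φ : NormalForm σ) : Set (Atom φ.sig FOVar) :=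
  {a | (∀ b : Atom φ.sig Unit, b.rename (fun _ => FOVar.x) ≠ a) ∧
    ∀ i, a ≠ Atom.bin (σ := φ.sig) (φ.f i) FOVar.y FOVar.x}

/-- A 2-type in `M_π` is given by its free atoms. -/
def equivFree (π : φ.OneType) :
    {τ : φ.TwoType // tp₁ τ = π ∧ ¬ IsMessage (inv τ)} ≃ Set (freeAtoms φ) where
  toFun τ := {a | a.1 ∈ τ.1}
  invFun S := ⟨{a | (∃ b ∈ π, b.rename (fun _ => FOVar.x) = a) ∨ ∃ h, (⟨a, h⟩ : freeAtoms φ) ∈ S}, by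
    constructor
    · ext b
      constructor
      · rintro (⟨b', hb', h⟩ | ⟨h, -⟩)
        · rwa [← rename_injective _ h]
        · exact absurd rfl (h.1 b)
      · exact fun h => Or.inl ⟨b, h, rfl⟩
    · rintro ⟨i, ⟨b, -, h⟩ | ⟨h, -⟩⟩
      · rcases b with ⟨p, a⟩ | ⟨r, a, b⟩
        · cases h
        · exact FOVar.noConfusion (congrArg (fun c => c.2.1) (Sum.inr.inj h))
      · exact h.2 i rfl⟩
  left_inv τ := by
    obtain ⟨τ, rfl, hτ⟩ := τ
    ext a
    constructor
    · rintro (⟨b, hb, rfl⟩ | ⟨_, h⟩)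
      · exact hb
      · exact h
    · intro h
      by_cases ha : ∃ b : Atom φ.sig Unit, b.rename (fun _ => FOVar.x) = a
      · obtain ⟨b, rfl⟩ := ha
        exact Or.inl ⟨b, h, rfl⟩
      · refine Or.inr ⟨⟨fun b hb => ha ⟨b, hb⟩, ?_⟩, h⟩
        intro i hi
        subst hi
        exact hτ ⟨i, by assumption⟩
  right_inv S := by
    ext a
    constructor
    · rintro (⟨b, -, h⟩ | ⟨_, h⟩)
      · exact absurd h (a.2.1 b)
      · exact h
    · exact fun h => Or.inr ⟨a.2, h⟩

theorem length_M_eq (π : φ.OneType) : (E.M π).length = 2 ^ Nat.card (freeAtoms φ) := by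
  classical
  have h₁ : (E.M π).length = Nat.card {τ // τ ∈ E.M π} := by
    rw [← List.toFinset_card_of_nodup (E.nodup_M π), ← Nat.card_eq_finsetCard]
    exact Nat.card_congr (Equiv.subtypeEquivRight fun τ => List.mem_toFinset)
  rw [h₁, Nat.card_congr ((Equiv.subtypeEquivRight (E.mem_M π)).trans (equivFree π)),
    Nat.card_eq_fintype_card, Nat.card_eq_fintype_card, Fintype.card_set]

/-- The length of `M_π` is `2 ^ q`, for every `π`. -/
theorem length_M (π : φ.OneType) : (E.M π).length = 2 ^ E.q := by
  rw [q, E.length_M_eq, E.length_M_eq, Nat.log_pow (by norm_num)]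

/-- Enumerations exist. -/
instance : Nonempty (Enumeration φ) := by
  classical
  exact ⟨{
    Pi := Finset.univ.toList
    Pi_nodup := Finset.nodup_toList _
    mem_Pi := by simp
    nonInv := fun π => ({τ | tp₁ τ = π ∧ IsNonInvertible τ} : Finset φ.TwoType).toList
    nonInv_nodup := fun _ => Finset.nodup_toList _
    mem_nonInv := by simp
    silent := fun π => ({τ | tp₁ τ = π ∧ IsSilent τ} : Finset φ.TwoType).toList
    silent_nodup := fun _ => Finset.nodup_toList _
    mem_silent := by simp }⟩

end Enumeration

/- ## Constraints and their solutions -/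

/-- Constraints over a set `V` of variables. -/
inductive Constraint (V : Type)
  /-- `∑ U = v` -/
  | sumEq (U : Finset V) (v : V)
  /-- `1 ≤ ∑ U` -/
  | oneLe (U : Finset V)
  /-- `v = 0` -/
  | zero (v : V)
  /-- `v > 0 ⇒ ∑ U ≥ D` -/
  | cond (v : V) (U : Finset V) (D : ℕ)

/-- Truth of a constraint under an assignment of values in `ℕ ∪ {ℵ₀}`, with `ℵ₀ = ⊤`. -/
def Constraint.Holds {V : Type} (θ : V → ℕ∞) : Constraint V → Prop
  | sumEq U v => ∑ u ∈ U, θ u = θ v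
  | oneLe U => 1 ≤ ∑ u ∈ U, θ u
  | zero v => θ v = 0
  | cond v U D => 0 < θ v → (D : ℕ∞) ≤ ∑ u ∈ U, θ u

/-- `θ` is a solution of `𝓒` over the domain `D ⊆ ℕ ∪ {ℵ₀}`. -/
def IsSolution {V : Type} (𝓒 : Set (Constraint V)) (D : Set ℕ∞) (θ : V → ℕ∞) : Prop :=
  (∀ v, θ v ∈ D) ∧ ∀ c ∈ 𝓒, c.Holds θ

/-- `𝓒` has a solution over the domain `D`. -/
def HasSolution {V : Type} (𝓒 : Set (Constraint V)) (D : Set ℕ∞) : Prop :=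
  ∃ θ, IsSolution 𝓒 D θ

/-- Propositional Horn clauses `⋀ body → head` over a set `V` of proposition letters; the head
`none` stands for `⊥`. -/
structure HornClause (V : Type) where
  body : Finset V
  head : Option V

/-- Truth of a Horn clause under a truth-value assignment. -/
def HornClause.Holds {V : Type} (X : V → Prop) (c : HornClause V) : Prop :=
  (∀ v ∈ c.body, X v) → ∃ v ∈ c.head, X v

/-- The Horn clauses of a constraint; the proposition letter of `v` stands for `v = 0`. -/
def Constraint.toHorn {V : Type} : Constraint V → Set (HornClause V)
  | sumEq U v => {⟨U, some v⟩} ∪ {c | ∃ u ∈ U, c = ⟨{v}, some u⟩}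
  | oneLe U => {⟨U, none⟩}
  | zero v => {⟨∅, some v⟩}
  | cond v U _ => {⟨U, some v⟩}

/-- The Horn clauses of a set of constraints. -/
def hornClauses {V : Type} (𝓒 : Set (Constraint V)) : Set (HornClause V) :=
  {d | ∃ c ∈ 𝓒, d ∈ c.toHorn}

/-- A set of Horn clauses has a satisfying truth-value assignment. -/
def HornSatisfiable {V : Type} (H : Set (HornClause V)) : Prop :=
  ∃ X : V → Prop, ∀ d ∈ H, d.Holds X

/- ## The constraints of a formula in normal form -/

/-- Vectors `u ≤ C`. -/
abbrev NormalForm.Vec {σ : Signature} (φ : NormalForm σ) : Type := Set.Iic φ.C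

/-- The vector `C - u`. -/
def NormalForm.Vec.compl {σ : Signature} {φ : NormalForm σ} (u : φ.Vec) : φ.Vec :=
  ⟨φ.C - u.1, fun i => Nat.sub_le (φ.C i) (u.1 i)⟩

namespace Enumeration

open NormalForm

variable {σ : Signature} {φ : NormalForm σ} (E : Enumeration φ)

/-- The set `V` of variables. -/
inductive V : Type
  /-- `x_τ`, for `τ` an invertible message-type -/
  | x (τ : {τ : φ.TwoType // IsInvertible τ})
  /-- `y_{π,s,u}`, for `|s| ≤ p` -/
  | y (π : φ.OneType) (s : {s : List Bool // s.length ≤ E.p}) (u : φ.Vec)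
  /-- `z_{π,t,u}`, for `|t| ≤ q` -/
  | z (π : φ.OneType) (t : {t : List Bool // t.length ≤ E.q}) (u : φ.Vec)
  /-- `ŷ_{π,s,v,w}`, for `|s| < p` -/
  | yhat (π : φ.OneType) (s : {s : List Bool // s.length < E.p}) (v w : φ.Vec)
  /-- `ẑ_{π,t,v,w}`, for `|t| < q` -/
  | zhat (π : φ.OneType) (t : {t : List Bool // t.length < E.q}) (v w : φ.Vec)

/-- The empty bit-string. -/
def nil {n : ℕ} : {s : List Bool // s.length ≤ n} := ⟨[], Nat.zero_le n⟩

/-- A bit-string of length less than `n` as one of length at most `n`. -/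
def weak {n : ℕ} (s : {s : List Bool // s.length < n}) : {s : List Bool // s.length ≤ n} :=
  ⟨s.1, s.2.le⟩

/-- The bit-string `sb`. -/
def snoc {n : ℕ} (s : {s : List Bool // s.length < n}) (b : Bool) :
    {s : List Bool // s.length ≤ n} :=
  ⟨s.1 ++ [b], by simpa using s.2⟩

open Classical in
/-- The first group of constraints. -/
inductive E₁ : Constraint E.V → Prop
  | zy (π : φ.OneType) (u : φ.Vec) :
      E₁ (.sumEq {.y π nil u.compl} (.z π nil u))
  | y_split (π : φ.OneType) (s : {s : List Bool // s.length < E.p}) (u : φ.Vec) :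
      E₁ (.sumEq
        (({vw : φ.Vec × φ.Vec | vw.1.1 + vw.2.1 = u.1} : Finset (φ.Vec × φ.Vec)).image
          fun vw => .yhat π s vw.1 vw.2)
        (.y π (weak s) u))
  | z_split (π : φ.OneType) (t : {t : List Bool // t.length < E.q}) (u : φ.Vec) :
      E₁ (.sumEq
        (({vw : φ.Vec × φ.Vec | vw.1.1 + vw.2.1 = u.1} : Finset (φ.Vec × φ.Vec)).image
          fun vw => .zhat π t vw.1 vw.2)
        (.z π (weak t) u))
  | y_left (π : φ.OneType) (s : {s : List Bool // s.length < E.p}) (v : φ.Vec) :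
      E₁ (.sumEq
        (({w : φ.Vec | v.1 + w.1 ≤ φ.C} : Finset φ.Vec).image fun w => .yhat π s v w)
        (.y π (snoc s false) v))
  | y_right (π : φ.OneType) (s : {s : List Bool // s.length < E.p}) (w : φ.Vec) :
      E₁ (.sumEq
        (({v : φ.Vec | v.1 + w.1 ≤ φ.C} : Finset φ.Vec).image fun v => .yhat π s v w)
        (.y π (snoc s true) w))
  | z_left (π : φ.OneType) (t : {t : List Bool // t.length < E.q}) (v : φ.Vec) :
      E₁ (.sumEq
        (({w : φ.Vec | v.1 + w.1 ≤ φ.C} : Finset φ.Vec).image fun w => .zhat π t v w)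
        (.z π (snoc t false) v))
  | z_right (π : φ.OneType) (t : {t : List Bool // t.length < E.q}) (w : φ.Vec) :
      E₁ (.sumEq
        (({v : φ.Vec | v.1 + w.1 ≤ φ.C} : Finset φ.Vec).image fun v => .zhat π t v w)
        (.z π (snoc t true) w))
  | nonempty :
      E₁ (.oneLe ((Finset.univ : Finset (φ.OneType × φ.Vec)).image fun πu => .y πu.1 nil πu.2))

open Classical in
/-- The second group of constraints. Where `|t| = q`, the list `M_{π,t}` has exactly one member
`τ = μ_{π,t}`. -/
inductive E₂ : Constraint E.V → Prop
  | y_leaf (π : φ.OneType) (s : {s : List Bool // s.length ≤ E.p}) (u : φ.Vec)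
      (hs : s.1.length = E.p) (hu : 0 < u.1) :
      E₂ (.sumEq
        (({τ : {τ : φ.TwoType // IsInvertible τ} | τ.1 ∈ E.Lam π s.1 ∧ vecOf τ.1 = u.1} :
          Finset {τ : φ.TwoType // IsInvertible τ}).image fun τ => .x τ)
        (.y π s u))
  | z_leaf (π : φ.OneType) (t : {t : List Bool // t.length ≤ E.q}) (u : φ.Vec)
      (ht : t.1.length = E.q) (hu : 0 < u.1) (τ : φ.TwoType) (hτ : τ ∈ piece (E.M π) t.1)
      (h : ¬ ∃ n : ℕ, u.1 = n • vecOf τ) :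
      E₂ (.zero (.z π t u))
  | x_inv (τ τ' : {τ : φ.TwoType // IsInvertible τ}) (h : τ'.1 = inv τ.1) :
      E₂ (.sumEq {.x τ'} (.x τ))
  | x_loop (τ : {τ : φ.TwoType // IsInvertible τ}) (h : tp₁ τ.1 = tp₂ τ.1) :
      E₂ (.zero (.x τ))
  | x_forbidden (τ : {τ : φ.TwoType // IsInvertible τ}) (h : IsForbidden τ.1) :
      E₂ (.zero (.x τ))
  | z_forbidden (π : φ.OneType) (t : {t : List Bool // t.length ≤ E.q}) (u : φ.Vec)
      (ht : t.1.length = E.q) (hu : 0 < u.1) (τ : φ.TwoType) (hτ : τ ∈ piece (E.M π) t.1)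
      (h : IsForbidden τ) :
      E₂ (.zero (.z π t u))

open Classical in
/-- The third group of constraints; again `τ = μ_{π,t}`. -/
inductive E₃ : Constraint E.V → Prop
  | target (π : φ.OneType) (t : {t : List Bool // t.length ≤ E.q}) (u : φ.Vec)
      (ht : t.1.length = E.q) (hu : 0 < u.1) (τ : φ.TwoType) (hτ : τ ∈ piece (E.M π) t.1) :
      E₃ (.cond (.z π t u)
        ((Finset.univ : Finset φ.Vec).image fun u' => .y (tp₂ τ) nil u')
        (3 * φ.m * φ.maxC))

/-- The set `𝓔 = 𝓔₁ ∪ 𝓔₂ ∪ 𝓔₃` of constraints. -/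
def system : Set (Constraint E.V) := {c | E.E₁ c ∨ E.E₂ c ∨ E.E₃ c}

end Enumeration

end GC2

namespace GC2

/- ## Constraints as conditions on the set of the positive variables -/

/-! Only the support of a solution matters. A sum in `ℕ∞` is non-zero iff some summand is, and a sum
with a summand `⊤` is `⊤`, so it reaches any bound. Hence the support of any solution satisfies the
conditions `PosHolds`, and any set satisfying them becomes a solution by giving its members the
value `⊤`. The contrapositives of these conditions are the Horn clauses
(`Constraint.horn_iff_posHolds`). This gives (b) and (c), and reduces (a) to supports: of the bound
`3mC` only its positivity is used.

From a model to a support: the new unary predicates encode a greedy colouring that gives distinct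
1-types to elements joined by one or two invertible messages (`IsModel.exists_isChromatic`). A
variable is then declared positive iff some element, or pair of elements, realises it. A leaf of the
tree over the 1-types now meets at most one invertible message of a given element, which is what the
leaf constraints for `y` express.

From a support to a model: splitting a positive `y` or `z` down its binary tree of bit-strings
yields a multiset of message-types, a star, with the prescribed vector. In the other direction, a
star at any node of the `y`-tree can be enlarged by climbing to the root, adding a star for the
sibling at each step and one for the complementary `z` at the end (`IsStar.exists_complete`). So
every invertible type with positive `x` occurs in a complete star.

The stars are unravelled into a tree. Each message leads to a new node carrying a star for the
target type. If the message is invertible, that star contains the inverse type, and its copy number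
`0` is the message to the parent instead of leading to a new child. Since the tree may be infinite,
no two elements have to share a witness and no cardinalities have to be balanced. Non-adjacent nodes
satisfy no binary atom, so the guards make the universal conjuncts vacuous there
(`Unravelling.tree_isModel`). -/

/-- The content of a constraint for the set of the variables with a non-zero value. -/
def Constraint.PosHolds {V : Type} (pos : V → Prop) : Constraint V → Prop
  | sumEq U v => pos v ↔ ∃ u ∈ U, pos u
  | oneLe U => ∃ u ∈ U, pos u
  | zero v => ¬ pos v
  | cond v U _ => pos v → ∃ u ∈ U, pos u

theorem Constraint.horn_iff_posHolds {V : Type} (X : V → Prop) (c : Constraint V) :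
    (∀ d ∈ c.toHorn, d.Holds X) ↔ c.PosHolds (fun v => ¬ X v) := by
  cases c with
  | sumEq U v =>
    simp only [toHorn, PosHolds, Set.mem_union, Set.mem_singleton_iff, Set.mem_ofPred_eq]
    constructor
    · intro h
      have h₁ : (∀ u ∈ U, X u) → X v := by simpa [HornClause.Holds] using h _ (Or.inl rfl)
      have h₂ : ∀ u ∈ U, X v → X u := fun u hu => by
        simpa [HornClause.Holds] using h _ (Or.inr ⟨u, hu, rfl⟩)
      constructor
      · intro hv
        by_contra! hu
        exact hv (h₁ hu)
      · rintro ⟨u, hu, h⟩ hv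
        exact h (h₂ u hu hv)
    · rintro h d (rfl | ⟨u, hu, rfl⟩)
      · suffices (∀ u ∈ U, X u) → X v by simpa [HornClause.Holds]
        intro hU
        by_contra hv
        obtain ⟨u, hu, hX⟩ := h.1 hv
        exact hX (hU u hu)
      · suffices X v → X u by simpa [HornClause.Holds]
        intro hv
        by_contra hX
        exact h.2 ⟨u, hu, hX⟩ hv
  | oneLe U => simp [toHorn, PosHolds, HornClause.Holds]
  | zero v => simp [toHorn, PosHolds, HornClause.Holds]
  | cond v U D =>
    simp only [toHorn, PosHolds, HornClause.Holds, Set.mem_singleton_iff, forall_eq,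
      Option.mem_def, Option.some.injEq, exists_eq_left']
    constructor
    · intro h hv
      by_contra! hu
      exact hv (h hu)
    · intro h hU
      by_contra hv
      obtain ⟨u, hu, hX⟩ := h hv
      exact hX (hU u hu)

/-- The bounds in the conditional constraints are positive. -/
def Constraint.Proper {V : Type} : Constraint V → Prop
  | cond _ _ D => 0 < D
  | _ => True

theorem sum_ne_zero_iff {V : Type} (U : Finset V) (θ : V → ℕ∞) :
    ∑ u ∈ U, θ u ≠ 0 ↔ ∃ u ∈ U, θ u ≠ 0 := by
  simp [Finset.sum_eq_zero_iff]

/-- Properness matters only for a conditional constraint, which with bound `0` would say nothing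
about its summands. -/
theorem Constraint.Holds.posHolds {V : Type} {θ : V → ℕ∞} {c : Constraint V} (hc : c.Proper)
    (h : c.Holds θ) : c.PosHolds (fun v => θ v ≠ 0) := by
  cases c with
  | sumEq U v =>
    change θ v ≠ 0 ↔ _
    rw [← sum_ne_zero_iff, show ∑ u ∈ U, θ u = θ v from h]
  | oneLe U => exact (sum_ne_zero_iff U θ).1 (Order.one_le_iff_ne_zero.1 h)
  | zero v => exact not_not.2 h
  | cond v U D =>
    intro hv
    refine (sum_ne_zero_iff U θ).1 fun h0 => ?_
    have h1 : (D : ℕ∞) ≤ ∑ u ∈ U, θ u := h (pos_iff_ne_zero.2 hv)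
    rw [h0, nonpos_iff_eq_zero, Nat.cast_eq_zero] at h1
    exact absurd h1 (ne_of_gt hc)

theorem sum_eq_top {V : Type} {U : Finset V} {θ : V → ℕ∞} (hθ : ∀ v, θ v ∈ ({0, ⊤} : Set ℕ∞))
    (h : ∃ u ∈ U, θ u ≠ 0) : ∑ u ∈ U, θ u = ⊤ := by
  obtain ⟨u, hu, h⟩ := h
  refine top_le_iff.1 (le_trans ?_ (Finset.single_le_sum (fun _ _ => zero_le) hu))
  rcases hθ u with h' | h'
  · exact absurd h' h
  · exact h'.ge

/-- With values in `{0, ⊤}` a sum is determined by whether it vanishes, and a non-zero sum exceeds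
every finite bound. -/
theorem Constraint.PosHolds.holds {V : Type} {θ : V → ℕ∞} (hθ : ∀ v, θ v ∈ ({0, ⊤} : Set ℕ∞))
    {c : Constraint V} (h : c.PosHolds (fun v => θ v ≠ 0)) : c.Holds θ := by
  cases c with
  | sumEq U v =>
    change ∑ u ∈ U, θ u = θ v
    by_cases hv : θ v = 0
    · rw [hv]
      by_contra h0
      exact h.2 ((sum_ne_zero_iff U θ).1 h0) hv
    · rw [sum_eq_top hθ (h.1 hv)]
      exact ((hθ v).resolve_left hv).symm
  | oneLe U => exact Order.one_le_iff_ne_zero.2 ((sum_ne_zero_iff U θ).2 h)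
  | zero v => exact not_not.1 h
  | cond v U D =>
    intro hv
    rw [sum_eq_top hθ (h (pos_iff_ne_zero.1 hv))]
    exact le_top

theorem horn_iff_forall_posHolds {V : Type} (𝓒 : Set (Constraint V)) (X : V → Prop) :
    (∀ d ∈ hornClauses 𝓒, d.Holds X) ↔ ∀ c ∈ 𝓒, c.PosHolds (fun v => ¬ X v) := by
  simp only [← Constraint.horn_iff_posHolds, hornClauses, Set.mem_ofPred_eq]
  exact ⟨fun h c hc d hd => h d ⟨c, hc, hd⟩, fun h d ⟨c, hc, hd⟩ => h c hc d hd⟩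

/-! ### Solutions over `{0, ⊤}` and models of the Horn clauses -/

section Solutions

variable {V : Type} {𝓒 : Set (Constraint V)}

theorem isSolution_iff_horn (h𝓒 : ∀ c ∈ 𝓒, c.Proper) {θ : V → ℕ∞}
    (hθ : ∀ v, θ v ∈ ({0, ⊤} : Set ℕ∞)) :
    IsSolution 𝓒 {0, ⊤} θ ↔ ∀ d ∈ hornClauses 𝓒, d.Holds (fun v => θ v = 0) := by
  rw [horn_iff_forall_posHolds]
  exact ⟨fun h c hc => (h.2 c hc).posHolds (h𝓒 c hc), fun h => ⟨hθ, fun c hc => (h c hc).holds hθ⟩⟩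

open Classical in
theorem hasSolution_iff_hornSatisfiable (h𝓒 : ∀ c ∈ 𝓒, c.Proper) :
    HasSolution 𝓒 {0, ⊤} ↔ HornSatisfiable (hornClauses 𝓒) := by
  constructor
  · rintro ⟨θ, h⟩
    exact ⟨_, (isSolution_iff_horn h𝓒 h.1).1 h⟩
  · rintro ⟨X, h⟩
    have hθ : ∀ v, (if X v then (0 : ℕ∞) else ⊤) ∈ ({0, ⊤} : Set ℕ∞) := by
      intro v
      split_ifs <;> simp
    refine ⟨fun v => if X v then 0 else ⊤, (isSolution_iff_horn h𝓒 hθ).2 ?_⟩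
    simpa using h

theorem hasSolution_univ_iff (h𝓒 : ∀ c ∈ 𝓒, c.Proper) :
    HasSolution 𝓒 Set.univ ↔ HasSolution 𝓒 {0, ⊤} := by
  constructor
  · rintro ⟨θ, h⟩
    rw [hasSolution_iff_hornSatisfiable h𝓒]
    exact ⟨fun v => θ v = 0, (horn_iff_forall_posHolds _ _).2 fun c hc =>
      (h.2 c hc).posHolds (h𝓒 c hc)⟩
  · rintro ⟨θ, h⟩
    exact ⟨θ, fun _ => trivial, h.2⟩

end Solutions

/- ## Evaluation of formulas -/

namespace Formula

theorem eval_conj {σ : Signature} {A : Type w} (S : Struct σ A) (L : List (Formula σ))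
    (θ : FOVar → A) : (conj L).Eval S θ ↔ ∀ ψ ∈ L, ψ.Eval S θ := by
  induction L with
  | nil => simp [conj, Eval]
  | cons ψ L ih => simp [conj, Eval, ih]

/-- The truth of a quantifier- and equality-free formula depends on its atoms only. -/
theorem eval_congr {σ : Signature} {W : Set FOVar} {A : Type*} {B : Type*} {S : Struct σ A}
    {T : Struct σ B} {θ : FOVar → A} {η : FOVar → B}
    (hun : ∀ p, ∀ v ∈ W, (S.un p (θ v) ↔ T.un p (η v)))
    (hbin : ∀ r, ∀ v ∈ W, ∀ v' ∈ W, (S.bin r (θ v) (θ v') ↔ T.bin r (η v) (η v')))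
    {ψ : Formula σ} (hψ : ψ.IsBoolean W) : ψ.Eval S θ ↔ ψ.Eval T η := by
  induction ψ with
  | atom a =>
    rcases a with ⟨p, v⟩ | ⟨r, v, v'⟩
    · exact hun p v hψ
    · exact hbin r v hψ.1 v' hψ.2
  | top => exact Iff.rfl
  | neg ψ ih => exact not_congr (ih hψ)
  | and ψ χ ih ih' => exact and_congr (ih hψ.1) (ih' hψ.2)
  | or ψ χ ih ih' => exact or_congr (ih hψ.1) (ih' hψ.2)
  | imp ψ χ ih ih' => exact imp_congr (ih hψ.1) (ih' hψ.2)
  | _ => exact hψ.elim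

end Formula

namespace NormalForm

variable {σ : Signature} {φ : NormalForm σ}

/-- Models of a formula in normal form, with the quantifiers spelt out. -/
structure IsModel (φ : NormalForm σ) {A : Type w} (S : Struct σ A) : Prop where
  α : ∀ a b, φ.α.Eval S (assign a b)
  β : ∀ h a b, a ≠ b → S.bin (φ.e h) a b → (φ.β h).Eval S (assign a b)
  f : ∀ a i, {b | S.bin (φ.f i) a b ∧ a ≠ b}.encard = φ.C i

theorem eval_toFormula {A : Type w} (S : Struct σ A) (θ : FOVar → A) :
    φ.toFormula.Eval S θ ↔ φ.IsModel S := by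
  have hxy : ∀ a b, update (update θ .x a) .y b = assign a b := fun a b => by
    funext v; cases v <;> rfl
  have hα : ∀ a b, φ.α.Eval S (update θ .x a) ↔ φ.α.Eval S (assign a b) := fun a b =>
    Formula.eval_congr (by rintro p v rfl; rfl) (by rintro r v rfl v' rfl; rfl) φ.α_boolean
  simp only [toFormula, Formula.Eval, Formula.eval_conj, List.forall_mem_ofFn_iff, hxy]
  constructor
  · rintro ⟨h₁, h₂, h₃⟩
    exact ⟨fun a b => (hα a b).1 (h₁ a), fun h a b hab hb => (h₂ h a b hb).resolve_right hab,
      fun a i => h₃ i a⟩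
  · rintro ⟨h₁, h₂, h₃⟩
    exact ⟨fun a => (hα a a).2 (h₁ a a), fun h a b hb => or_iff_not_imp_right.2 fun hab =>
      h₂ h a b hab hb, fun i a => h₃ a i⟩

theorem satisfiable_iff :
    Formula.Satisfiable.{w} φ.toFormula ↔
      ∃ (A : Type w) (_ : Nonempty A) (S : Struct σ A), φ.IsModel S := by
  constructor
  · rintro ⟨A, S, θ, h⟩
    exact ⟨A, ⟨θ .x⟩, S, (eval_toFormula S θ).1 h⟩
  · rintro ⟨A, ⟨a⟩, S, h⟩
    exact ⟨A, S, fun _ => a, (eval_toFormula S _).2 h⟩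

/- ## Types realised in a structure -/

section Realised

variable {A : Type w} (S : Struct φ.sig A)

/-- The 1-type of an element. -/
def oneOf (a : A) : φ.OneType := {γ | γ.Holds S (fun _ => a)}

/-- The 2-type of a pair of elements. -/
def twoOf (a b : A) : φ.TwoType := {γ | γ.Holds S (assign a b)}

theorem tp₁_twoOf (a b : A) : tp₁ (twoOf S a b) = oneOf S a := by
  ext (⟨p, v⟩ | ⟨r, v, v'⟩) <;> rfl

theorem inv_twoOf (a b : A) : inv (twoOf S a b) = twoOf S b a := by
  ext (⟨p, v⟩ | ⟨r, v, v'⟩)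
  · cases v <;> rfl
  · cases v <;> cases v' <;> rfl

theorem tp₂_twoOf (a b : A) : tp₂ (twoOf S a b) = oneOf S b := by
  rw [tp₂, inv_twoOf, tp₁_twoOf]

theorem inv_inv (τ : φ.TwoType) : inv (inv τ) = τ := by
  ext (⟨p, v⟩ | ⟨r, v, v'⟩)
  · cases v <;> rfl
  · cases v <;> cases v' <;> rfl

/-- The formula that defines forbidden types is quantifier- and equality-free, so the 2-type of a
pair decides it: all pairs realising the type agree. -/
theorem isForbidden_twoOf_iff (a b : A) :
    ¬ IsForbidden (twoOf S a b) ↔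
      φ.α.Eval S.reduct (assign a b) ∧ φ.α.Eval S.reduct (assign b a) ∧
      (∀ h, S.bin (φ.e h) a b → (φ.β h).Eval S.reduct (assign a b)) ∧
      (∀ h, S.bin (φ.e h) b a → (φ.β h).Eval S.reduct (assign b a)) := by
  have key : ∀ {B : Type} (T : Struct φ.sig B) (a' b' : B),
      (∀ γ : Atom φ.sig FOVar, γ.Holds S (assign a b) ↔ γ.Holds T (assign a' b')) →
      ((φ.α.Eval S.reduct (assign a b) ∧ φ.α.Eval S.reduct (assign b a) ∧
      (∀ h, S.bin (φ.e h) a b → (φ.β h).Eval S.reduct (assign a b)) ∧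
      (∀ h, S.bin (φ.e h) b a → (φ.β h).Eval S.reduct (assign b a))) ↔
      (φ.α.Eval T.reduct (assign a' b') ∧ φ.α.Eval T.reduct (assign b' a') ∧
      (∀ h, T.bin (φ.e h) a' b' → (φ.β h).Eval T.reduct (assign a' b')) ∧
      (∀ h, T.bin (φ.e h) b' a' → (φ.β h).Eval T.reduct (assign b' a')))) := by
    intro B T a' b' hγ
    have h₁ : ∀ {W : Set FOVar} {ψ : Formula σ}, ψ.IsBoolean W →
        (ψ.Eval S.reduct (assign a b) ↔ ψ.Eval T.reduct (assign a' b')) := fun hψ =>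
      Formula.eval_congr (fun p v _ => hγ (.inl (.inl p, v)))
        (fun r v _ v' _ => hγ (.inr (r, v, v'))) hψ
    have h₂ : ∀ {W : Set FOVar} {ψ : Formula σ}, ψ.IsBoolean W →
        (ψ.Eval S.reduct (assign b a) ↔ ψ.Eval T.reduct (assign b' a')) := fun hψ => by
      refine Formula.eval_congr (fun p v _ => ?_) (fun r v _ v' _ => ?_) hψ
      · have := hγ (.inl (.inl p, v.swap))
        cases v <;> exact this
      · have := hγ (.inr (r, v.swap, v'.swap))
        cases v <;> cases v' <;> exact this
    refine and_congr (h₁ φ.α_boolean) (and_congr (h₂ φ.α_boolean) (and_congr ?_ ?_))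
    · exact forall_congr' fun h => imp_congr (hγ (.inr (φ.e h, .x, .y))) (h₁ (φ.β_boolean h))
    · exact forall_congr' fun h => imp_congr (hγ (.inr (φ.e h, .y, .x))) (h₂ (φ.β_boolean h))
  rw [IsForbidden, not_not]
  constructor
  · rintro ⟨B, T, a', b', h₁, h₂, h₃, h₄, h₅, h₆⟩
    refine (key T a' b' fun γ => ⟨h₅ γ, fun h => ?_⟩).2 ⟨h₁, h₂, h₃, h₄⟩
    by_contra hγ
    exact h₆ γ hγ h
  · intro h
    -- `IsForbidden` ranges over domains in `Type`, whereas `A` lies in another universe; pulling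
    -- `S` back to the two variables gives a small witness with the same atoms.
    let T : Struct φ.sig FOVar :=
      ⟨fun p v => S.un p (assign a b v), fun r v v' => S.bin r (assign a b v) (assign a b v')⟩
    have hT : ∀ γ : Atom φ.sig FOVar,
        γ.Holds S (assign a b) ↔ γ.Holds T (assign FOVar.x FOVar.y) := by
      rintro (⟨p, v⟩ | ⟨r, v, v'⟩)
      · cases v <;> rfl
      · cases v <;> cases v' <;> rfl
    obtain ⟨h₁, h₂, h₃, h₄⟩ := (key T .x .y hT).1 h
    exact ⟨FOVar, T, .x, .y, h₁, h₂, h₃, h₄, fun γ hγ => (hT γ).1 hγ,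
      fun γ hγ h => hγ ((hT γ).2 h)⟩

/-- Distinctness excludes the alternative `x ≈ y` in the guarded conjuncts. -/
theorem IsModel.not_isForbidden {S : Struct φ.sig A} (hS : φ.IsModel S.reduct) {a b : A}
    (hab : a ≠ b) : ¬ IsForbidden (twoOf S a b) :=
  (isForbidden_twoOf_iff S a b).2 ⟨hS.α a b, hS.α b a, fun h => hS.β h a b hab,
    fun h => hS.β h b a hab.symm⟩

end Realised

theorem isInvertible_inv {τ : φ.TwoType} (h : IsInvertible τ) : IsInvertible (inv τ) :=
  ⟨h.2, (inv_inv τ).symm ▸ h.1⟩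

theorem maxC_pos : 0 < φ.maxC :=
  (φ.C_pos ⟨0, φ.m_pos⟩).trans_le (Finset.le_sup (f := φ.C) (Finset.mem_univ _))

end NormalForm

/- ## Halving lists -/

section Pieces

variable {γ : Type}

theorem piece_append (L : List γ) (s : List Bool) (b : Bool) :
    piece L (s ++ [b]) = half (piece L s) b := by
  simp [piece]

theorem half_sublist (L : List γ) (b : Bool) : (half L b).Sublist L := by
  cases b
  · exact List.take_sublist _ _
  · exact List.drop_sublist _ _

theorem mem_half (L : List γ) (a : γ) : a ∈ L ↔ a ∈ half L false ∨ a ∈ half L true := by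
  conv_lhs => rw [← List.take_append_drop (L.length / 2) L]
  exact List.mem_append

theorem disjoint_half {L : List γ} (h : L.Nodup) {a : γ} (h₀ : a ∈ half L false) :
    a ∉ half L true := by
  rw [← List.take_append_drop (L.length / 2) L] at h
  exact fun h₁ => (List.nodup_append'.1 h).2.2 h₀ h₁

theorem piece_sublist (L : List γ) (s : List Bool) : (piece L s).Sublist L := by
  induction s using List.reverseRecOn with
  | nil => exact List.Sublist.refl _
  | append_singleton s b ih =>
    rw [piece_append]
    exact (half_sublist _ b).trans ih

theorem length_piece {L : List γ} {n : ℕ} (hL : L.length = 2 ^ n) (s : List Bool)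
    (hs : s.length ≤ n) : (piece L s).length = 2 ^ (n - s.length) := by
  induction s using List.reverseRecOn with
  | nil => simpa [piece] using hL
  | append_singleton s b ih =>
    simp only [List.length_append, List.length_singleton] at hs ⊢
    have h := ih (by omega)
    obtain ⟨k, hk⟩ : ∃ k, n - s.length = k + 1 := ⟨n - s.length - 1, by omega⟩
    rw [hk, pow_succ] at h
    rw [piece_append, show n - (s.length + 1) = k by omega]
    cases b
    · rw [half, List.length_take, h]
      omega
    · rw [half, List.length_drop, h]
      omega

theorem piece_eq_singleton {L : List γ} {n : ℕ} (hL : L.length = 2 ^ n) (s : List Bool)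
    (hs : s.length = n) : ∃ a, piece L s = [a] := by
  have h := length_piece hL s hs.le
  rw [hs, Nat.sub_self, pow_zero] at h
  exact List.length_eq_one_iff.1 h

/-- Every member of a list lies in a piece of every depth. -/
theorem exists_mem_piece {L : List γ} {a : γ} (ha : a ∈ L) (n : ℕ) :
    ∃ s : List Bool, s.length = n ∧ a ∈ piece L s := by
  induction n with
  | zero => exact ⟨[], rfl, ha⟩
  | succ n ih =>
    obtain ⟨s, rfl, h⟩ := ih
    rcases (mem_half _ _).1 h with h | h
    · exact ⟨s ++ [false], by simp, by rwa [piece_append]⟩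
    · exact ⟨s ++ [true], by simp, by rwa [piece_append]⟩

end Pieces

theorem Enumeration.proper_of_mem_system {σ : Signature} {φ : NormalForm σ} (E : Enumeration φ)
    (c : Constraint E.V) (hc : c ∈ E.system) : c.Proper := by
  rcases hc with h | h | h
  · cases h <;> trivial
  · cases h <;> trivial
  · cases h
    exact Nat.mul_pos (Nat.mul_pos (by norm_num) φ.m_pos) NormalForm.maxC_pos

end GC2

namespace GC2

/- ## Chromatic models -/

/-- Greedy colouring of an infinite graph of bounded degree. -/
theorem exists_coloring {A : Type w} {K : Type} [Fintype K] {R : A → A → Prop}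
    (hR : ∀ a b, R a b → R b a) {d : ℕ} (hd : ∀ a, {b | R a b}.encard ≤ d)
    (hK : d < Fintype.card K) : ∃ col : A → K, ∀ a b, R a b → a ≠ b → col a ≠ col b := by
  have step : ∀ (a : A) (g : ∀ b, WellOrderingRel b a → K),
      ∃ k, ∀ b h, R a b → g b h ≠ k := by
    intro a g
    -- If every colour were taken, choosing an already coloured neighbour of each colour would
    -- inject `K` into the at most `d` neighbours of `a`.
    by_contra! hg
    choose b h hb hk using hg
    have hinj : Function.Injective b := by
      intro k k' e
      rw [← hk k, ← hk k']
      congr 1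
    have h₁ := hinj.encard_range.trans
      ((Set.encard_le_encard (Set.range_subset_iff.2 hb)).trans (hd a))
    rw [ENat.card_eq_coe_fintype_card, Nat.cast_le] at h₁
    omega
  have wf : WellFounded (WellOrderingRel (α := A)) := IsWellFounded.wf
  choose F hF using step
  have hcol : ∀ a b, WellOrderingRel b a → R a b → wf.fix F b ≠ wf.fix F a := by
    intro a b hba hab
    rw [wf.fix_eq F a]
    exact hF a (fun b _ => wf.fix F b) b hba hab
  refine ⟨wf.fix F, fun a b hab hne => ?_⟩
  rcases trichotomous_of WellOrderingRel a b with h | h | h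
  · exact hcol b a h (hR a b hab)
  · exact absurd h hne
  · exact (hcol a b h hab).symm

namespace NormalForm

variable {σ : Signature} {φ : NormalForm σ} {A : Type w}

/-- Distinct elements joined by a chain of one or two invertible messages have distinct 1-types. -/
structure IsChromatic (S : Struct φ.sig A) : Prop where
  one : ∀ a b, a ≠ b → IsInvertible (twoOf S a b) → oneOf S a ≠ oneOf S b
  two : ∀ a b c, a ≠ b → a ≠ c → b ≠ c → IsInvertible (twoOf S a b) →
    IsInvertible (twoOf S a c) → oneOf S b ≠ oneOf S c

/-- `b` is joined to `a` by an invertible message. -/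
def Linked (φ : NormalForm σ) (S : Struct σ A) (a b : A) : Prop :=
  a ≠ b ∧ (∃ i, S.bin (φ.f i) a b) ∧ ∃ i, S.bin (φ.f i) b a

theorem Linked.symm {S : Struct σ A} {a b : A} (h : φ.Linked S a b) : φ.Linked S b a :=
  ⟨h.1.symm, h.2.2, h.2.1⟩

theorem IsModel.finite_out {S : Struct σ A} (hS : φ.IsModel S) (a : A) (i : Fin φ.m) :
    {b | S.bin (φ.f i) a b ∧ a ≠ b}.Finite :=
  Set.finite_of_encard_eq_coe (hS.f a i)

theorem IsModel.exists_linked {S : Struct σ A} (hS : φ.IsModel S) (a : A) :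
    ∃ I : Finset A, (∀ b, b ∈ I ↔ φ.Linked S a b) ∧ I.card ≤ φ.m * φ.maxC := by
  classical
  let J : Finset A := Finset.univ.biUnion fun i => (hS.finite_out a i).toFinset
  refine ⟨J.filter (φ.Linked S a), fun b => ?_, (Finset.card_filter_le _ _).trans ?_⟩
  · simp only [J, Finset.mem_filter, Finset.mem_biUnion, Finset.mem_univ, true_and,
      Set.Finite.mem_toFinset, Set.mem_ofPred_eq, and_iff_right_iff_imp]
    rintro ⟨h, ⟨i, hi⟩, -⟩
    exact ⟨i, hi, h⟩
  · refine (Finset.card_biUnion_le_card_mul _ _ φ.maxC fun i _ => ?_).trans (by simp)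
    have h : ((hS.finite_out a i).toFinset.card : ℕ∞) = φ.C i := by
      rw [← hS.f a i, (hS.finite_out a i).encard_eq_coe_toFinset_card]
    rw [Nat.cast_inj.1 h]
    exact Finset.le_sup (Finset.mem_univ i)

theorem IsModel.encard_chain_le {S : Struct σ A} (hS : φ.IsModel S) (a : A) :
    {b | a ≠ b ∧ (φ.Linked S a b ∨ ∃ c, φ.Linked S a c ∧ φ.Linked S c b)}.encard ≤
      ((φ.m * φ.maxC) ^ 2 : ℕ) := by
  classical
  choose I hI hcard using hS.exists_linked
  -- Each of the at most `mC` partners `c` of `a` contributes itself and its own partners except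
  -- `a`. As `a` is one of these, inserting `c` and erasing `a` cancel, leaving at most `mC`
  -- elements per `c`.
  let J : Finset A := (I a).biUnion fun c => insert c ((I c).erase a)
  have hJ : J.card ≤ (φ.m * φ.maxC) ^ 2 := by
    rw [sq]
    refine (Finset.card_biUnion_le_card_mul _ _ _ fun c hc => ?_).trans
      (Nat.mul_le_mul_right _ (hcard a))
    refine (Finset.card_insert_le _ _).trans ?_
    rw [Finset.card_erase_add_one ((hI c a).2 ((hI a c).1 hc).symm)]
    exact hcard c
  refine (Set.encard_le_encard (t := (J : Set A)) ?_).trans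
    (by rw [Set.encard_coe_eq_coe_finsetCard]; exact_mod_cast hJ)
  rintro b ⟨hab, h | ⟨c, hac, hcb⟩⟩
  · exact Finset.mem_biUnion.2 ⟨b, (hI a b).2 h, Finset.mem_insert_self _ _⟩
  · exact Finset.mem_biUnion.2 ⟨c, (hI a c).2 hac,
      Finset.mem_insert_of_mem (Finset.mem_erase.2 ⟨hab.symm, (hI c b).2 hcb⟩)⟩

/-- Every model has a chromatic expansion. -/
theorem IsModel.exists_isChromatic {S : Struct σ A} (hS : φ.IsModel S) :
    ∃ T : Struct φ.sig A, T.reduct = S ∧ IsChromatic T := by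
  let k := Nat.clog 2 ((φ.m * φ.maxC) ^ 2 + 1)
  -- A colour is a set of new predicates, so there are `2 ^ k` colours, more than the degree bound.
  have hK : (φ.m * φ.maxC) ^ 2 < Fintype.card (Set (Fin k)) := by
    rw [Fintype.card_set, Fintype.card_fin]
    exact Nat.le_pow_clog (by norm_num) _
  obtain ⟨col, hcol⟩ := exists_coloring
    (R := fun a b => a ≠ b ∧ (φ.Linked S a b ∨ ∃ c, φ.Linked S a c ∧ φ.Linked S c b))
    (by
      rintro a b ⟨hab, h | ⟨c, hac, hcb⟩⟩
      · exact ⟨hab.symm, Or.inl h.symm⟩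
      · exact ⟨hab.symm, Or.inr ⟨c, hcb.symm, hac.symm⟩⟩)
    hS.encard_chain_le hK
  let T : Struct φ.sig A := ⟨fun p a => Sum.elim (fun p => S.un p a) (fun j => j ∈ col a) p, S.bin⟩
  have hT : ∀ a b, oneOf T a = oneOf T b → col a = col b := by
    intro a b h
    ext j
    exact Set.ext_iff.1 h (.inl (.inr j, ()))
  have hL : ∀ a b, a ≠ b → IsInvertible (twoOf T a b) → φ.Linked S a b := by
    rintro a b hab ⟨h₁, h₂⟩
    rw [inv_twoOf] at h₂
    exact ⟨hab, h₁, h₂⟩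
  -- Equal 1-types would give equal colours, although the elements are adjacent in the coloured
  -- graph: directly in the first case, through `a` in the second.
  refine ⟨T, rfl, fun a b hab h he => ?_, fun a b c hab hac hbc h h' he => ?_⟩
  · exact hcol a b ⟨hab, Or.inl (hL a b hab h)⟩ hab (hT a b he)
  · exact hcol b c ⟨hbc, Or.inr ⟨a, (hL a b hab h).symm, hL a c hac h'⟩⟩ hbc (hT b c he)

/- ## Vectors realised in a model -/

/-- The `i`-th entry is the number of the `fᵢ`-successors of `a` to which `a` is related by a
2-type in `T`. -/
noncomputable def vecIn (S : Struct φ.sig A) (T : Set φ.TwoType) (a : A) : Fin φ.m → ℕ :=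
  fun i => {b | a ≠ b ∧ twoOf S a b ∈ T ∧ S.bin (φ.f i) a b}.ncard

section VecIn

variable {S : Struct φ.sig A} (hS : φ.IsModel S.reduct)

include hS

/-- Needed because `ncard` is `0` on infinite sets, so `vecIn` counts properly only in the presence
of finiteness. -/
theorem finite_vecIn (T : Set φ.TwoType) (a : A) (i : Fin φ.m) :
    {b | a ≠ b ∧ twoOf S a b ∈ T ∧ S.bin (φ.f i) a b}.Finite :=
  (hS.finite_out a i).subset fun _ h => ⟨h.2.2, h.1⟩

theorem vecIn_le (T : Set φ.TwoType) (a : A) : vecIn S T a ≤ φ.C := by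
  intro i
  have h : {b | a ≠ b ∧ twoOf S a b ∈ T ∧ S.bin (φ.f i) a b}.encard ≤ φ.C i := by
    rw [← hS.f a i]
    exact Set.encard_le_encard fun _ h => ⟨h.2.2, h.1⟩
  rw [← (finite_vecIn hS T a i).cast_ncard_eq] at h
  exact_mod_cast h

theorem vecIn_eq_C {T : Set φ.TwoType} {a : A}
    (hT : ∀ τ, IsMessage τ → tp₁ τ = oneOf S a → τ ∈ T) : vecIn S T a = φ.C := by
  funext i
  have h : {b | a ≠ b ∧ twoOf S a b ∈ T ∧ S.bin (φ.f i) a b} =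
      {b | S.reduct.bin (φ.f i) a b ∧ a ≠ b} := by
    ext b
    exact ⟨fun h => ⟨h.2.2, h.1⟩, fun h => ⟨h.2, hT _ ⟨i, h.1⟩ (tp₁_twoOf S a b), h.1⟩⟩
  rw [vecIn, h, Set.ncard, hS.f a i, ENat.toNat_natCast]

theorem vecIn_add {T T₀ T₁ : Set φ.TwoType} (a : A) (hT : ∀ τ, τ ∈ T ↔ τ ∈ T₀ ∨ τ ∈ T₁)
    (hd : ∀ τ, τ ∈ T₀ → τ ∉ T₁) : vecIn S T₀ a + vecIn S T₁ a = vecIn S T a := by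
  funext i
  rw [Pi.add_apply, vecIn, vecIn, vecIn, ← Set.ncard_union_eq _ (finite_vecIn hS T₀ a i)
    (finite_vecIn hS T₁ a i)]
  · congr 1
    ext b
    simp only [Set.mem_union, Set.mem_ofPred_eq, hT]
    tauto
  · exact Set.disjoint_left.2 fun b h h' => hd _ h.2.1 h'.2.1

end VecIn

/-- The elements reached by `τ` are the same for every `fᵢ` in `τ`, so all non-zero entries
coincide. -/
theorem vecIn_singleton (S : Struct φ.sig A) (τ : φ.TwoType) (a : A) :
    ∃ n : ℕ, vecIn S {τ} a = n • vecOf τ := by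
  refine ⟨{b | a ≠ b ∧ twoOf S a b = τ}.ncard, ?_⟩
  funext i
  by_cases h : Sends τ i
  · rw [Pi.smul_apply, vecOf, if_pos h, smul_eq_mul, mul_one]
    refine congrArg Set.ncard (Set.ext fun b => ?_)
    constructor
    · exact fun h' => ⟨h'.1, h'.2.1⟩
    · rintro ⟨hab, rfl⟩
      exact ⟨hab, rfl, h⟩
  · simp only [vecIn, vecOf, Pi.smul_apply, if_neg h, smul_eq_mul, mul_zero]
    convert Set.ncard_empty A
    refine Set.eq_empty_of_forall_notMem fun b hb => h ?_
    rw [← (show twoOf S a b = τ from hb.2.1)]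
    exact hb.2.2

theorem exists_of_vecIn_pos {S : Struct φ.sig A} {T : Set φ.TwoType} {a : A}
    (h : 0 < vecIn S T a) : ∃ b, a ≠ b ∧ twoOf S a b ∈ T := by
  by_contra! hb
  refine h.ne' (funext fun i => ?_)
  refine (congrArg Set.ncard ?_).trans (Set.ncard_empty A)
  exact Set.eq_empty_of_forall_notMem fun b h' => hb b h'.1 h'.2.1

theorem vecIn_eq_vecOf {S : Struct φ.sig A} {T : Set φ.TwoType} {a b : A} (hab : a ≠ b)
    (hT : twoOf S a b ∈ T) (hu : ∀ c, a ≠ c → twoOf S a c ∈ T → c = b) :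
    vecIn S T a = vecOf (twoOf S a b) := by
  funext i
  by_cases h : Sends (twoOf S a b) i
  · rw [vecOf, if_pos h, vecIn]
    convert Set.ncard_singleton b
    ext c
    constructor
    · exact fun hc => hu c hc.1 hc.2.1
    · rintro rfl
      exact ⟨hab, hT, h⟩
  · rw [vecOf, if_neg h, vecIn]
    convert Set.ncard_empty A
    refine Set.eq_empty_of_forall_notMem fun c hc => h ?_
    rw [← hu c hc.1 hc.2.1]
    exact hc.2.2

end NormalForm

/-! ### A chromatic model satisfies the constraints -/

namespace Enumeration

open NormalForm

variable {σ : Signature} {φ : NormalForm σ} (E : Enumeration φ)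

theorem mem_Lam_half (π : φ.OneType) (s : List Bool) (τ : φ.TwoType) :
    τ ∈ E.Lam π s ↔ τ ∈ E.Lam π (s ++ [false]) ∨ τ ∈ E.Lam π (s ++ [true]) := by
  simp only [Lam, Set.mem_ofPred_eq, piece_append, mem_half (piece E.Pi s)]
  tauto

theorem disjoint_Lam_half (π : φ.OneType) (s : List Bool) (τ : φ.TwoType)
    (h : τ ∈ E.Lam π (s ++ [false])) : τ ∉ E.Lam π (s ++ [true]) := by
  simp only [Lam, Set.mem_ofPred_eq, piece_append] at h ⊢
  exact fun h' => disjoint_half (E.Pi_nodup.sublist (piece_sublist _ s)) h.2.2 h'.2.2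

/-- The set of the members of `M_{π,t}`. -/
def Mu (π : φ.OneType) (t : List Bool) : Set φ.TwoType := {τ | τ ∈ piece (E.M π) t}

theorem mem_Mu_half (π : φ.OneType) (t : List Bool) (τ : φ.TwoType) :
    τ ∈ E.Mu π t ↔ τ ∈ E.Mu π (t ++ [false]) ∨ τ ∈ E.Mu π (t ++ [true]) := by
  simp only [Mu, Set.mem_ofPred_eq, piece_append, mem_half (piece (E.M π) t)]

theorem disjoint_Mu_half (π : φ.OneType) (t : List Bool) (τ : φ.TwoType)
    (h : τ ∈ E.Mu π (t ++ [false])) : τ ∉ E.Mu π (t ++ [true]) := by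
  simp only [Mu, Set.mem_ofPred_eq, piece_append] at h ⊢
  exact disjoint_half ((E.nodup_M π).sublist (piece_sublist _ t)) h

theorem mem_M_of_mem_piece {π : φ.OneType} {t : List Bool} {τ : φ.TwoType}
    (h : τ ∈ piece (E.M π) t) : tp₁ τ = π ∧ ¬ IsMessage (inv τ) :=
  (E.mem_M π τ).1 ((piece_sublist _ t).subset h)

theorem Mu_eq_singleton {π : φ.OneType} {t : List Bool} (ht : t.length = E.q) {τ : φ.TwoType}
    (hτ : τ ∈ piece (E.M π) t) : E.Mu π t = {τ} := by
  obtain ⟨τ', h⟩ := piece_eq_singleton (E.length_M π) t ht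
  ext ρ
  simp only [Mu, h, List.mem_singleton, Set.mem_ofPred_eq, Set.mem_singleton_iff] at hτ ⊢
  rw [hτ]

variable {A : Type w} {S : Struct φ.sig A}

/-- At a leaf only one target 1-type is left, and chromaticity forbids two invertible partners of
`a` with that 1-type, so `b` alone is counted. -/
theorem vecIn_Lam (hχ : IsChromatic S) {π : φ.OneType} {s : List Bool} (hs : s.length = E.p)
    {a b : A} (hab : a ≠ b) (h : twoOf S a b ∈ E.Lam π s) :
    vecIn S (E.Lam π s) a = vecOf (twoOf S a b) := by
  refine vecIn_eq_vecOf hab h fun c hac hc => ?_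
  by_contra hcb
  refine hχ.two a c b hac hab hcb hc.1 h.1 ?_
  obtain ⟨π', hπ'⟩ := piece_eq_singleton E.length_Pi s hs
  have h₁ := h.2.2
  have h₂ := hc.2.2
  rw [hπ', List.mem_singleton, tp₂_twoOf] at h₁ h₂
  rw [h₁, h₂]

/-- The variables with a non-zero value in the solution obtained from a model. -/
def Realised (S : Struct φ.sig A) : E.V → Prop
  | .x τ => ∃ a b, a ≠ b ∧ twoOf S a b = τ.1
  | .y π s u => ∃ a, oneOf S a = π ∧ vecIn S (E.Lam π s.1) a = u.1
  | .z π t u => ∃ a, oneOf S a = π ∧ vecIn S (E.Mu π t.1) a = u.1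
  | .yhat π s v w => ∃ a, oneOf S a = π ∧ vecIn S (E.Lam π (s.1 ++ [false])) a = v.1 ∧
      vecIn S (E.Lam π (s.1 ++ [true])) a = w.1
  | .zhat π t v w => ∃ a, oneOf S a = π ∧ vecIn S (E.Mu π (t.1 ++ [false])) a = v.1 ∧
      vecIn S (E.Mu π (t.1 ++ [true])) a = w.1

section Constraints

variable (hS : φ.IsModel S.reduct)

include hS

theorem vecIn_Lam_half (π : φ.OneType) (s : List Bool) (a : A) :
    vecIn S (E.Lam π (s ++ [false])) a + vecIn S (E.Lam π (s ++ [true])) a =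
      vecIn S (E.Lam π s) a :=
  vecIn_add hS a (E.mem_Lam_half π s) (E.disjoint_Lam_half π s)

theorem vecIn_Mu_half (π : φ.OneType) (t : List Bool) (a : A) :
    vecIn S (E.Mu π (t ++ [false])) a + vecIn S (E.Mu π (t ++ [true])) a =
      vecIn S (E.Mu π t) a :=
  vecIn_add hS a (E.mem_Mu_half π t) (E.disjoint_Mu_half π t)

/-- A message-type sent by `a` is invertible or not, and lies in the first or the second set
accordingly. Silent types in the second set contribute nothing. -/
theorem vecIn_Lam_add_Mu (a : A) :
    vecIn S (E.Lam (oneOf S a) []) a + vecIn S (E.Mu (oneOf S a) []) a = φ.C := by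
  rw [vecIn_add hS (T := E.Lam (oneOf S a) [] ∪ E.Mu (oneOf S a) []) a (fun _ => Iff.rfl)]
  · refine vecIn_eq_C hS fun τ hτ h => ?_
    by_cases hi : IsMessage (inv τ)
    · exact Or.inl ⟨⟨hτ, hi⟩, h, E.mem_Pi _⟩
    · exact Or.inr ((E.mem_M _ _).2 ⟨h, hi⟩)
  · exact fun τ h h' => ((E.mem_M _ _).1 h').2 h.1.2

theorem realised_E₁ [Nonempty A] {c : Constraint E.V} (hc : E.E₁ c) :
    c.PosHolds (E.Realised S) := by
  cases hc with
  | zy π u =>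
    simp only [Constraint.PosHolds, Finset.mem_singleton, exists_eq_left, Realised]
    refine exists_congr fun a => and_congr_right ?_
    rintro rfl
    -- The two vectors add up to `C`, so one is `C - u` iff the other is `u`; truncated subtraction
    -- is exact because `u ≤ C`.
    have h := E.vecIn_Lam_add_Mu hS a
    have hu := u.2
    simp only [NormalForm.Vec.compl, nil, funext_iff, Pi.sub_apply, Pi.add_apply, Set.mem_Iic,
      Pi.le_def] at h hu ⊢
    refine forall_congr' fun i => ?_
    have h₁ := h i
    have h₂ := hu i
    omega
  | y_split π s u =>
    simp only [Constraint.PosHolds, Finset.mem_image, Finset.mem_filter, Finset.mem_univ,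
      true_and, Prod.exists]
    constructor
    · rintro ⟨a, ha, h⟩
      refine ⟨_, ⟨⟨_, vecIn_le hS _ a⟩, ⟨_, vecIn_le hS _ a⟩, ?_, rfl⟩, a, ha, rfl, rfl⟩
      rw [← h]
      exact E.vecIn_Lam_half hS π s.1 a
    · rintro ⟨_, ⟨v, w, h, rfl⟩, a, ha, hv, hw⟩
      refine ⟨a, ha, ?_⟩
      rw [← h, ← hv, ← hw]
      exact (E.vecIn_Lam_half hS π s.1 a).symm
  | z_split π t u =>
    simp only [Constraint.PosHolds, Finset.mem_image, Finset.mem_filter, Finset.mem_univ,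
      true_and, Prod.exists]
    constructor
    · rintro ⟨a, ha, h⟩
      refine ⟨_, ⟨⟨_, vecIn_le hS _ a⟩, ⟨_, vecIn_le hS _ a⟩, ?_, rfl⟩, a, ha, rfl, rfl⟩
      rw [← h]
      exact E.vecIn_Mu_half hS π t.1 a
    · rintro ⟨_, ⟨v, w, h, rfl⟩, a, ha, hv, hw⟩
      refine ⟨a, ha, ?_⟩
      rw [← h, ← hv, ← hw]
      exact (E.vecIn_Mu_half hS π t.1 a).symm
  | y_left π s v =>
    simp only [Constraint.PosHolds, Finset.mem_image, Finset.mem_filter, Finset.mem_univ,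
      true_and]
    constructor
    · rintro ⟨a, ha, h⟩
      refine ⟨_, ⟨⟨_, vecIn_le hS _ a⟩, ?_, rfl⟩, a, ha, h, rfl⟩
      rw [← h]
      exact (E.vecIn_Lam_half hS π s.1 a).trans_le (vecIn_le hS _ a)
    · rintro ⟨_, ⟨w, h, rfl⟩, a, ha, hv, hw⟩
      exact ⟨a, ha, hv⟩
  | y_right π s w =>
    simp only [Constraint.PosHolds, Finset.mem_image, Finset.mem_filter, Finset.mem_univ,
      true_and]
    constructor
    · rintro ⟨a, ha, h⟩
      refine ⟨_, ⟨⟨_, vecIn_le hS _ a⟩, ?_, rfl⟩, a, ha, rfl, h⟩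
      rw [← h]
      exact (E.vecIn_Lam_half hS π s.1 a).trans_le (vecIn_le hS _ a)
    · rintro ⟨_, ⟨w, h, rfl⟩, a, ha, hv, hw⟩
      exact ⟨a, ha, hw⟩
  | z_left π t v =>
    simp only [Constraint.PosHolds, Finset.mem_image, Finset.mem_filter, Finset.mem_univ,
      true_and]
    constructor
    · rintro ⟨a, ha, h⟩
      refine ⟨_, ⟨⟨_, vecIn_le hS _ a⟩, ?_, rfl⟩, a, ha, h, rfl⟩
      rw [← h]
      exact (E.vecIn_Mu_half hS π t.1 a).trans_le (vecIn_le hS _ a)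
    · rintro ⟨_, ⟨w, h, rfl⟩, a, ha, hv, hw⟩
      exact ⟨a, ha, hv⟩
  | z_right π t w =>
    simp only [Constraint.PosHolds, Finset.mem_image, Finset.mem_filter, Finset.mem_univ,
      true_and]
    constructor
    · rintro ⟨a, ha, h⟩
      refine ⟨_, ⟨⟨_, vecIn_le hS _ a⟩, ?_, rfl⟩, a, ha, rfl, h⟩
      rw [← h]
      exact (E.vecIn_Mu_half hS π t.1 a).trans_le (vecIn_le hS _ a)
    · rintro ⟨_, ⟨w, h, rfl⟩, a, ha, hv, hw⟩
      exact ⟨a, ha, hw⟩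
  | nonempty =>
    classical
    obtain ⟨a⟩ := ‹Nonempty A›
    exact ⟨_, Finset.mem_image.2 ⟨(oneOf S a, ⟨_, vecIn_le hS (E.Lam (oneOf S a) []) a⟩),
      Finset.mem_univ _, rfl⟩,
      a, rfl, rfl⟩

/-- Chromaticity enters through `y_leaf` and `x_loop`; the other cases hold in any model. -/
theorem realised_E₂ (hχ : IsChromatic S) {c : Constraint E.V} (hc : E.E₂ c) :
    c.PosHolds (E.Realised S) := by
  cases hc with
  | y_leaf π s u hs hu =>
    simp only [Constraint.PosHolds, Finset.mem_image, Finset.mem_filter, Finset.mem_univ,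
      true_and]
    constructor
    · rintro ⟨a, ha, h⟩
      rw [← h] at hu
      obtain ⟨b, hab, hb⟩ := exists_of_vecIn_pos hu
      exact ⟨_, ⟨⟨twoOf S a b, hb.1⟩, ⟨hb, (E.vecIn_Lam hχ hs hab hb).symm.trans h⟩, rfl⟩,
        a, b, hab, rfl⟩
    · rintro ⟨_, ⟨⟨τ, _⟩, ⟨hτ, h⟩, rfl⟩, a, b, hab, rfl⟩
      exact ⟨a, (tp₁_twoOf S a b).symm.trans hτ.2.1, (E.vecIn_Lam hχ hs hab hτ).trans h⟩
  | z_leaf π t u ht hu τ hτ h =>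
    rintro ⟨a, -, ha⟩
    rw [E.Mu_eq_singleton ht hτ] at ha
    obtain ⟨n, hn⟩ := vecIn_singleton S τ a
    exact h ⟨n, ha.symm.trans hn⟩
  | x_inv τ τ' h =>
    simp only [Constraint.PosHolds, Finset.mem_singleton, exists_eq_left, Realised, h]
    constructor
    · rintro ⟨a, b, hab, h⟩
      exact ⟨b, a, hab.symm, by rw [← h, inv_twoOf]⟩
    · rintro ⟨a, b, hab, h⟩
      exact ⟨b, a, hab.symm, by rw [← inv_inv τ.1, ← h, inv_twoOf]⟩
  | x_loop τ h =>
    rintro ⟨a, b, hab, hτ⟩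
    refine hχ.one a b hab (hτ ▸ τ.2) ?_
    rw [← tp₁_twoOf S a b, ← tp₂_twoOf S a b, hτ, h]
  | x_forbidden τ h =>
    rintro ⟨a, b, hab, hτ⟩
    exact hS.not_isForbidden hab (hτ ▸ h)
  | z_forbidden π t u ht hu τ hτ h =>
    rintro ⟨a, -, ha⟩
    rw [E.Mu_eq_singleton ht hτ] at ha
    rw [← ha] at hu
    obtain ⟨b, hab, hb⟩ := exists_of_vecIn_pos hu
    rw [Set.mem_singleton_iff] at hb
    exact hS.not_isForbidden hab (hb ▸ h)

theorem realised_E₃ {c : Constraint E.V} (hc : E.E₃ c) : c.PosHolds (E.Realised S) := by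
  cases hc with
  | target π t u ht hu τ hτ =>
    rintro ⟨a, -, ha⟩
    rw [E.Mu_eq_singleton ht hτ] at ha
    rw [← ha] at hu
    obtain ⟨b, hab, hb⟩ := exists_of_vecIn_pos hu
    rw [Set.mem_singleton_iff] at hb
    classical
    refine ⟨_, Finset.mem_image.2 ⟨⟨_, vecIn_le hS _ b⟩, Finset.mem_univ _, rfl⟩, b, ?_, rfl⟩
    rw [← hb, tp₂_twoOf]

end Constraints

/-- A model yields a set of positive variables that satisfies all constraints. -/
theorem exists_posHolds_of_isModel [Nonempty A] {S : Struct σ A} (hS : φ.IsModel S) :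
    ∃ pos : E.V → Prop, ∀ c ∈ E.system, c.PosHolds pos := by
  obtain ⟨T, rfl, hT⟩ := hS.exists_isChromatic
  refine ⟨E.Realised T, fun c hc => ?_⟩
  rcases hc with h | h | h
  · exact E.realised_E₁ hS h
  · exact E.realised_E₂ hS hT h
  · exact E.realised_E₃ hS h

end Enumeration

end GC2

namespace GC2

open NormalForm

namespace Enumeration

variable {σ : Signature} {φ : NormalForm σ} (E : Enumeration φ)

/- ## Stars obtained from a set of positive variables -/

/-- The message-types that may be used in a model, given the set of the positive variables. -/
structure Feasible (pos : E.V → Prop) (τ : φ.TwoType) : Prop where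
  isMessage : IsMessage τ
  not_forbidden : ¬ IsForbidden τ
  pos_x : ∀ h : IsInvertible τ, pos (.x ⟨τ, h⟩)
  target : ¬ IsMessage (inv τ) → ∃ u, pos (.y (tp₂ τ) nil u)

/-- The numbers `n τ` of messages of type `τ` sent by an element of type `π` add up to the
vector `u`. -/
structure IsStar (pos : E.V → Prop) (π : φ.OneType) (u : Fin φ.m → ℕ) (n : φ.TwoType → ℕ) :
    Prop where
  feasible : ∀ τ, n τ ≠ 0 → tp₁ τ = π ∧ E.Feasible pos τ
  sum : ∑ τ, n τ • vecOf τ = u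

variable {E} {pos : E.V → Prop} {π : φ.OneType}

theorem IsStar.zero : E.IsStar pos π 0 0 :=
  ⟨fun _ h => absurd rfl h, by simp⟩

theorem IsStar.add {u v : Fin φ.m → ℕ} {n n' : φ.TwoType → ℕ} (h : E.IsStar pos π u n)
    (h' : E.IsStar pos π v n') : E.IsStar pos π (u + v) (n + n') := by
  constructor
  · intro τ hτ
    by_cases h0 : n τ = 0
    · exact h'.feasible τ fun h0' => hτ (by simp [h0, h0'])
    · exact h.feasible τ h0
  · simp only [Pi.add_apply, add_smul, Finset.sum_add_distrib, h.sum, h'.sum]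

open Classical in
theorem IsStar.single {τ : φ.TwoType} (hπ : tp₁ τ = π) (h : E.Feasible pos τ) (k : ℕ) :
    E.IsStar pos π (k • vecOf τ) (Pi.single τ k) := by
  constructor
  · intro ρ hρ
    obtain rfl : ρ = τ := by
      by_contra hne
      exact hρ (by rw [Pi.single_eq_of_ne hne])
    exact ⟨hπ, h⟩
  · rw [Finset.sum_eq_single τ]
    · rw [Pi.single_eq_same]
    · intro ρ _ hne
      rw [Pi.single_eq_of_ne hne, zero_smul]
    · exact fun h => absurd (Finset.mem_univ _) h

theorem vecOf_eq_zero {τ : φ.TwoType} (h : ¬ IsMessage τ) : vecOf τ = 0 :=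
  funext fun i => if_neg fun hi => h ⟨i, hi⟩

theorem vecOf_pos {τ : φ.TwoType} (h : IsMessage τ) : 0 < vecOf τ := by
  obtain ⟨i, hi⟩ := h
  refine pos_iff_ne_zero.2 fun h0 => ?_
  have := congrFun h0 i
  rw [vecOf, if_pos hi] at this
  exact one_ne_zero this

theorem vecOf_le (τ : φ.TwoType) : vecOf τ ≤ φ.C := by
  intro i
  rw [vecOf]
  split_ifs
  · exact φ.C_pos i
  · exact Nat.zero_le _

section Stars

variable (h𝓔 : ∀ c ∈ E.system, c.PosHolds pos)

include h𝓔

theorem feasible_of_pos_x {τ : {τ : φ.TwoType // IsInvertible τ}} (h : pos (.x τ)) :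
    E.Feasible pos τ.1 where
  isMessage := τ.2.1
  not_forbidden hf := h𝓔 _ (Or.inr (Or.inl (.x_forbidden τ hf))) h
  pos_x _ := h
  target hi := absurd τ.2.2 hi

theorem exists_yhat {s : List Bool} {hs : s.length < E.p} {u : φ.Vec}
    (h : pos (.y π ⟨s, hs.le⟩ u)) :
    ∃ v w : φ.Vec, v.1 + w.1 = u.1 ∧ pos (.yhat π ⟨s, hs⟩ v w) := by
  have := (h𝓔 _ (Or.inl (.y_split π ⟨s, hs⟩ u))).1 h
  simp only [Finset.mem_image, Finset.mem_filter, Finset.mem_univ, true_and, Prod.exists] at this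
  obtain ⟨_, ⟨v, w, hu, rfl⟩, hp⟩ := this
  exact ⟨v, w, hu, hp⟩

theorem exists_zhat {t : List Bool} {ht : t.length < E.q} {u : φ.Vec}
    (h : pos (.z π ⟨t, ht.le⟩ u)) :
    ∃ v w : φ.Vec, v.1 + w.1 = u.1 ∧ pos (.zhat π ⟨t, ht⟩ v w) := by
  have := (h𝓔 _ (Or.inl (.z_split π ⟨t, ht⟩ u))).1 h
  simp only [Finset.mem_image, Finset.mem_filter, Finset.mem_univ, true_and, Prod.exists] at this
  obtain ⟨_, ⟨v, w, hu, rfl⟩, hp⟩ := this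
  exact ⟨v, w, hu, hp⟩

theorem pos_y_halves {s : {s : List Bool // s.length < E.p}} {v w : φ.Vec}
    (hvw : v.1 + w.1 ≤ φ.C) (h : pos (.yhat π s v w)) :
    pos (.y π (snoc s false) v) ∧ pos (.y π (snoc s true) w) := by
  classical
  refine ⟨(h𝓔 _ (Or.inl (.y_left π s v))).2 ⟨_, ?_, h⟩,
    (h𝓔 _ (Or.inl (.y_right π s w))).2 ⟨_, ?_, h⟩⟩
  · exact Finset.mem_image.2 ⟨w, by simpa using hvw, rfl⟩
  · exact Finset.mem_image.2 ⟨v, by simpa using hvw, rfl⟩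

theorem pos_z_halves {t : {t : List Bool // t.length < E.q}} {v w : φ.Vec}
    (hvw : v.1 + w.1 ≤ φ.C) (h : pos (.zhat π t v w)) :
    pos (.z π (snoc t false) v) ∧ pos (.z π (snoc t true) w) := by
  classical
  refine ⟨(h𝓔 _ (Or.inl (.z_left π t v))).2 ⟨_, ?_, h⟩,
    (h𝓔 _ (Or.inl (.z_right π t w))).2 ⟨_, ?_, h⟩⟩
  · exact Finset.mem_image.2 ⟨w, by simpa using hvw, rfl⟩
  · exact Finset.mem_image.2 ⟨v, by simpa using hvw, rfl⟩

/-- A positive variable `y_{π,s,u}` yields a star with vector `u`. -/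
theorem exists_isStar_of_y (k : ℕ) (s : List Bool) (hs : s.length ≤ E.p)
    (hk : s.length + k = E.p) (u : φ.Vec) (h : pos (.y π ⟨s, hs⟩ u)) :
    ∃ n, E.IsStar pos π u.1 n := by
  induction k generalizing s u with
  | zero =>
    -- The leaf constraint is imposed for non-zero vectors only; the zero vector is served by the
    -- empty star.
    rcases eq_or_ne u.1 0 with hu | hu
    · exact ⟨0, hu ▸ IsStar.zero⟩
    · have := (h𝓔 _ (Or.inr (Or.inl (.y_leaf π ⟨s, hs⟩ u hk (pos_iff_ne_zero.2 hu))))).1 h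
      simp only [Finset.mem_image, Finset.mem_filter, Finset.mem_univ, true_and] at this
      obtain ⟨_, ⟨τ, ⟨hτ, hv⟩, rfl⟩, hp⟩ := this
      rw [← hv, ← one_smul ℕ (vecOf τ.1)]
      exact ⟨_, IsStar.single hτ.2.1 (feasible_of_pos_x h𝓔 hp) 1⟩
  | succ k ih =>
    obtain ⟨v, w, hvw, hp⟩ := exists_yhat h𝓔 (hs := by omega) h
    obtain ⟨h₀, h₁⟩ := pos_y_halves h𝓔 (hvw.trans_le u.2) hp
    obtain ⟨n₀, hn₀⟩ := ih _ _ (by simp; omega) v h₀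
    obtain ⟨n₁, hn₁⟩ := ih _ _ (by simp; omega) w h₁
    exact ⟨_, hvw ▸ hn₀.add hn₁⟩

theorem feasible_of_pos_z {t : {t : List Bool // t.length ≤ E.q}} {u : φ.Vec}
    (ht : t.1.length = E.q) (hu : 0 < u.1) {τ : φ.TwoType} (hτ : τ ∈ piece (E.M π) t.1)
    (hm : IsMessage τ) (h : pos (.z π t u)) : E.Feasible pos τ where
  isMessage := hm
  not_forbidden hf := h𝓔 _ (Or.inr (Or.inl (.z_forbidden π t u ht hu τ hτ hf))) h
  pos_x hi := absurd hi.2 (E.mem_M_of_mem_piece hτ).2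
  target _ := by
    have := h𝓔 _ (Or.inr (Or.inr (.target π t u ht hu τ hτ))) h
    simp only [Finset.mem_image, Finset.mem_univ, true_and] at this
    obtain ⟨_, ⟨u', rfl⟩, hp⟩ := this
    exact ⟨u', hp⟩

/-- A positive variable `z_{π,t,u}` yields a star with vector `u`. -/
theorem exists_isStar_of_z (k : ℕ) (t : List Bool) (ht : t.length ≤ E.q)
    (hk : t.length + k = E.q) (u : φ.Vec) (h : pos (.z π ⟨t, ht⟩ u)) :
    ∃ n, E.IsStar pos π u.1 n := by
  induction k generalizing t u with
  | zero =>
    rcases eq_or_ne u.1 0 with hu | hu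
    · exact ⟨0, hu ▸ IsStar.zero⟩
    · have hu' := pos_iff_ne_zero.2 hu
      obtain ⟨τ, hτ⟩ := piece_eq_singleton (E.length_M π) t hk
      replace hτ : τ ∈ piece (E.M π) t := by simp [hτ]
      have hn : ∃ n : ℕ, u.1 = n • vecOf τ := by
        by_contra hn
        exact h𝓔 _ (Or.inr (Or.inl (.z_leaf π ⟨t, ht⟩ u hk hu' τ hτ hn))) h
      obtain ⟨n, hn⟩ := hn
      -- A multiple of the vector of a silent type is zero, so the leaf carries a message-type.
      have hm : IsMessage τ := by
        by_contra hm
        rw [vecOf_eq_zero hm, smul_zero] at hn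
        exact hu hn
      rw [hn]
      exact ⟨_, IsStar.single (E.mem_M_of_mem_piece hτ).1
        (feasible_of_pos_z h𝓔 (t := ⟨t, ht⟩) hk hu' hτ hm h) n⟩
  | succ k ih =>
    obtain ⟨v, w, hvw, hp⟩ := exists_zhat h𝓔 (ht := by omega) h
    obtain ⟨h₀, h₁⟩ := pos_z_halves h𝓔 (hvw.trans_le u.2) hp
    obtain ⟨n₀, hn₀⟩ := ih _ _ (by simp; omega) v h₀
    obtain ⟨n₁, hn₁⟩ := ih _ _ (by simp; omega) w h₁
    exact ⟨_, hvw ▸ hn₀.add hn₁⟩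

/-- A star whose vector is that of a positive variable `y_{π,s,u}` can be completed. -/
theorem IsStar.exists_complete (s : List Bool) (hs : s.length ≤ E.p) (u : φ.Vec)
    (h : pos (.y π ⟨s, hs⟩ u)) (n : φ.TwoType → ℕ) (hn : E.IsStar pos π u.1 n) :
    ∃ n', n ≤ n' ∧ E.IsStar pos π φ.C n' := by
  classical
  induction s using List.reverseRecOn generalizing u n with
  | nil =>
    -- At the root the missing vector is `C - u`, and the constraint linking `z` and `y` makes its
    -- `z`-variable positive.
    have hc : u.compl.compl = u := Subtype.ext (tsub_tsub_cancel_of_le u.2)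
    have hz : pos (.z π nil u.compl) :=
      (h𝓔 _ (Or.inl (.zy π u.compl))).2 ⟨_, Finset.mem_singleton_self _, hc.symm ▸ h⟩
    obtain ⟨n', hn'⟩ := exists_isStar_of_z h𝓔 E.q [] (Nat.zero_le _) (by simp) _ hz
    have hC : u.1 + u.compl.1 = φ.C := add_tsub_cancel_of_le u.2
    exact ⟨n + n', le_self_add, hC ▸ hn.add hn'⟩
  | append_singleton s b ih =>
    have hs' : s.length < E.p := by simpa using hs
    -- One step up: once the sibling's star is added, the star fits the parent `s` with vector `v +
    -- w`.
    have hw : ∀ v w : φ.Vec, v.1 + w.1 ≤ φ.C → pos (.yhat π ⟨s, hs'⟩ v w) →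
        ∀ m, n ≤ m → E.IsStar pos π (v.1 + w.1) m →
        ∃ n', n ≤ n' ∧ E.IsStar pos π φ.C n' := by
      intro v w hvw hp m hnm hm
      obtain ⟨n', h₁, h₂⟩ := ih hs'.le ⟨v.1 + w.1, hvw⟩
        ((h𝓔 _ (Or.inl (.y_split π ⟨s, hs'⟩ ⟨v.1 + w.1, hvw⟩))).2
          ⟨_, Finset.mem_image.2 ⟨(v, w), by simp, rfl⟩, hp⟩) m hm
      exact ⟨n', hnm.trans h₁, h₂⟩
    have hk : ∀ b : Bool, (s ++ [b]).length + (E.p - s.length - 1) = E.p := by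
      intro b
      simp only [List.length_append, List.length_singleton]
      omega
    cases b with
    | false =>
      have := (h𝓔 _ (Or.inl (.y_left π ⟨s, hs'⟩ u))).1 h
      simp only [Finset.mem_image, Finset.mem_filter, Finset.mem_univ, true_and] at this
      obtain ⟨_, ⟨w, hvw, rfl⟩, hp⟩ := this
      obtain ⟨m, hm⟩ := exists_isStar_of_y h𝓔 _ _ _ (hk true) w (pos_y_halves h𝓔 hvw hp).2
      exact hw u w hvw hp _ le_self_add (hn.add hm)
    | true =>
      have := (h𝓔 _ (Or.inl (.y_right π ⟨s, hs'⟩ u))).1 h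
      simp only [Finset.mem_image, Finset.mem_filter, Finset.mem_univ, true_and] at this
      obtain ⟨_, ⟨v, hvw, rfl⟩, hp⟩ := this
      obtain ⟨m, hm⟩ := exists_isStar_of_y h𝓔 _ _ _ (hk false) v (pos_y_halves h𝓔 hvw hp).1
      exact hw v u hvw hp _ le_add_self (hm.add hn)

theorem exists_isStar {u : φ.Vec} (h : pos (.y π nil u)) : ∃ n, E.IsStar pos π φ.C n := by
  obtain ⟨n, hn⟩ := exists_isStar_of_y h𝓔 E.p [] (Nat.zero_le _) (by simp) u h
  obtain ⟨n', -, hn'⟩ := hn.exists_complete h𝓔 [] (Nat.zero_le _) u h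
  exact ⟨n', hn'⟩

/-- Start with one copy of `τ` at the leaf of its target 1-type and complete it; completion never
removes messages. -/
theorem exists_isStar_of_x {τ : {τ : φ.TwoType // IsInvertible τ}} (h : pos (.x τ)) :
    ∃ n, E.IsStar pos (tp₁ τ.1) φ.C n ∧ n τ.1 ≠ 0 := by
  classical
  obtain ⟨s, hs, hmem⟩ := exists_mem_piece (E.mem_Pi (tp₂ τ.1)) E.p
  have hy : pos (.y (tp₁ τ.1) ⟨s, hs.le⟩ ⟨vecOf τ.1, vecOf_le _⟩) :=
    (h𝓔 _ (Or.inr (Or.inl (.y_leaf (tp₁ τ.1) ⟨s, hs.le⟩ ⟨vecOf τ.1, vecOf_le _⟩ hs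
      (vecOf_pos τ.2.1))))).2 ⟨_, Finset.mem_image.2 ⟨τ, Finset.mem_filter.2
        ⟨Finset.mem_univ _, ⟨τ.2, rfl, hmem⟩, rfl⟩, rfl⟩, h⟩
  have hn := IsStar.single (E := E) (pos := pos) rfl (feasible_of_pos_x h𝓔 h) 1
  rw [one_smul] at hn
  obtain ⟨n', h₁, h₂⟩ := IsStar.exists_complete h𝓔 s hs.le ⟨vecOf τ.1, vecOf_le _⟩ hy _ hn
  refine ⟨n', h₂, fun h0 => ?_⟩
  have := h₁ τ.1
  rw [Pi.single_eq_same, h0] at this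
  exact Nat.not_succ_le_zero 0 this

/-- The target of a feasible message can be equipped with a star. -/
theorem Feasible.exists_next {τ : φ.TwoType} (h : E.Feasible pos τ) :
    ∃ n, E.IsStar pos (tp₂ τ) φ.C n ∧ (IsMessage (inv τ) → n (inv τ) ≠ 0) := by
  by_cases hi : IsMessage (inv τ)
  · have hinv : IsInvertible τ := ⟨h.isMessage, hi⟩
    -- The equality of `x` on a type and its inverse lets the target's star be chosen to contain the
    -- reply.
    have hp : pos (.x ⟨inv τ, isInvertible_inv hinv⟩) := by
      refine (h𝓔 _ (Or.inr (Or.inl (.x_inv ⟨inv τ, isInvertible_inv hinv⟩ ⟨τ, hinv⟩ ?_)))).2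
        ⟨_, Finset.mem_singleton_self _, h.pos_x hinv⟩
      exact (inv_inv τ).symm
    obtain ⟨n, hn, hn'⟩ := exists_isStar_of_x h𝓔 hp
    exact ⟨n, hn, fun _ => hn'⟩
  · obtain ⟨u, hu⟩ := h.target hi
    obtain ⟨n, hn⟩ := exists_isStar h𝓔 hu
    exact ⟨n, hn, fun h => absurd h hi⟩

end Stars

/- ## Unravelling stars into a tree-shaped model -/

/-- A star for the root of a tree, and a star for the target of each message-type. -/
structure Unravelling (E : Enumeration φ) (pos : E.V → Prop) where
  rootType : φ.OneType
  rootStar : φ.TwoType → ℕ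
  next : φ.TwoType → φ.TwoType → ℕ
  root_isStar : E.IsStar pos rootType φ.C rootStar
  next_isStar : ∀ τ, E.Feasible pos τ → E.IsStar pos (tp₂ τ) φ.C (next τ)
  next_inv : ∀ τ, E.Feasible pos τ → IsMessage (inv τ) → next τ (inv τ) ≠ 0

theorem nonempty_unravelling (h𝓔 : ∀ c ∈ E.system, c.PosHolds pos) :
    Nonempty (Unravelling E pos) := by
  have h := h𝓔 _ (Or.inl .nonempty)
  simp only [Constraint.PosHolds, Finset.mem_image, Finset.mem_univ, true_and] at h
  obtain ⟨_, ⟨⟨π, u⟩, rfl⟩, hp⟩ := h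
  obtain ⟨n₀, hn₀⟩ := exists_isStar h𝓔 hp
  have hnext : ∀ τ, ∃ n, E.Feasible pos τ →
      E.IsStar pos (tp₂ τ) φ.C n ∧ (IsMessage (inv τ) → n (inv τ) ≠ 0) := by
    intro τ
    by_cases hτ : E.Feasible pos τ
    · obtain ⟨n, hn⟩ := hτ.exists_next h𝓔
      exact ⟨n, fun _ => hn⟩
    -- An infeasible type labels no edge of the tree, so its star is arbitrary.
    · exact ⟨0, fun h => absurd h hτ⟩
  choose next hnext using hnext
  exact ⟨⟨π, n₀, next, hn₀, fun τ hτ => (hnext τ hτ).1, fun τ hτ => (hnext τ hτ).2⟩⟩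

namespace Unravelling

variable (U : Unravelling E pos)

/-- The star of a path; a path is a list of messages, the last one first, and a message is a
message-type with a number that distinguishes messages of the same type. -/
def starAt : List (φ.TwoType × ℕ) → φ.TwoType → ℕ
  | [] => U.rootStar
  | (τ, _) :: _ => U.next τ

/-- The 1-type of a path. -/
def oneAt : List (φ.TwoType × ℕ) → φ.OneType
  | [] => U.rootType
  | (τ, _) :: _ => tp₂ τ

/-- The message that the end of a path sends back to its predecessor. -/
def Back : List (φ.TwoType × ℕ) → φ.TwoType × ℕ → Prop
  | [], _ => False
  | (τ, _) :: _, x => IsMessage (inv τ) ∧ x = (inv τ, 0)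

/-- The paths that are nodes of the tree. -/
inductive IsNode : List (φ.TwoType × ℕ) → Prop
  | nil : IsNode []
  | cons (a : List (φ.TwoType × ℕ)) (τ : φ.TwoType) (k : ℕ) (ha : IsNode a)
      (hk : k < U.starAt a τ) (hb : ¬ Back a (τ, k)) : IsNode ((τ, k) :: a)

variable {U}

theorem IsNode.isStar {a : List (φ.TwoType × ℕ)} (ha : U.IsNode a) :
    E.IsStar pos (U.oneAt a) φ.C (U.starAt a) := by
  induction ha with
  | nil => exact U.root_isStar
  | cons a τ k ha hk hb ih => exact U.next_isStar τ (ih.feasible τ (by omega)).2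

theorem IsNode.tail {a : List (φ.TwoType × ℕ)} {x : φ.TwoType × ℕ} (h : U.IsNode (x :: a)) :
    U.IsNode a := by
  cases h
  assumption

theorem IsNode.feasible {a : List (φ.TwoType × ℕ)} {τ : φ.TwoType} {k : ℕ}
    (h : U.IsNode ((τ, k) :: a)) : tp₁ τ = U.oneAt a ∧ E.Feasible pos τ := by
  cases h with
  | cons _ _ _ ha hk hb => exact ha.isStar.feasible τ (by omega)

open Classical in
/-- The neighbour of `a` to which it sends the message `x`. -/
noncomputable def neighbour (a : List (φ.TwoType × ℕ)) (x : φ.TwoType × ℕ) :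
    List (φ.TwoType × ℕ) :=
  if Back a x then a.tail else x :: a

theorem IsNode.neighbour {a : List (φ.TwoType × ℕ)} (ha : U.IsNode a) {x : φ.TwoType × ℕ}
    (hx : x.2 < U.starAt a x.1) : U.IsNode (neighbour a x) := by
  unfold Unravelling.neighbour
  split_ifs with hb
  · cases a with
    | nil => exact ha
    | cons y a => exact ha.tail
  · exact .cons a x.1 x.2 ha hx hb

theorem back_unique {a : List (φ.TwoType × ℕ)} {x y : φ.TwoType × ℕ} (hx : Back a x)
    (hy : Back a y) : x = y := by
  cases a with
  | nil => exact hx.elim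
  | cons z a => exact hx.2.trans hy.2.symm

/-- Different messages lead to different children, at most one message goes to the parent, and path
lengths separate parent from child. -/
theorem neighbour_injective (a : List (φ.TwoType × ℕ)) : Function.Injective (neighbour a) := by
  intro x y h
  unfold neighbour at h
  split_ifs at h with hx hy hy
  · exact back_unique hx hy
  · have := congrArg List.length h
    simp only [List.length_tail, List.length_cons] at this
    omega
  · have := congrArg List.length h
    simp only [List.length_tail, List.length_cons] at this
    omega
  · exact (List.cons.inj h).1

/-! ### The tree-shaped structure and its types -/

variable (U)

/-- The domain of the tree-shaped model. -/
abbrev Node : Type w := ULift.{w} {a : List (φ.TwoType × ℕ) // U.IsNode a}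

/-- The tree-shaped model; no binary predicate holds of nodes that are not adjacent. -/
def tree : Struct φ.sig U.Node where
  un p a := Sum.inl (p, ()) ∈ U.oneAt a.down.1
  bin r a b := (a = b ∧ Sum.inr (r, (), ()) ∈ U.oneAt a.down.1) ∨
    (∃ τ k, b.down.1 = (τ, k) :: a.down.1 ∧ Sum.inr (r, .x, .y) ∈ τ) ∨
    ∃ τ k, a.down.1 = (τ, k) :: b.down.1 ∧ Sum.inr (r, .y, .x) ∈ τ

theorem oneOf_tree (a : U.Node) : oneOf U.tree a = U.oneAt a.down.1 := by
  ext (⟨p, v⟩ | ⟨r, v, v'⟩)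
  · rfl
  · change (_ ∨ _) ↔ _
    simp

/-- Atoms in a single variable are governed by the 1-types of the two ends, which match `tp₁ τ` and
`tp₂ τ`; the mixed atoms are read off from `τ` by the definition of `tree`. -/
theorem twoOf_tree {a b : U.Node} {τ : φ.TwoType} {k : ℕ} (h : b.down.1 = (τ, k) :: a.down.1) :
    twoOf U.tree a b = τ := by
  have hτ : tp₁ τ = oneOf U.tree a := by
    rw [oneOf_tree]
    exact (IsNode.feasible (h ▸ b.down.2)).1
  have hτ' : tp₂ τ = oneOf U.tree b := by
    rw [oneOf_tree, h]
    rfl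
  have hne : a ≠ b := by
    rintro rfl
    simpa using congrArg List.length h
  have hba : ∀ x, a.down.1 ≠ x :: b.down.1 := by
    intro x hx
    have h₁ := congrArg List.length h
    have h₂ := congrArg List.length hx
    simp only [List.length_cons] at h₁ h₂
    omega
  simp only [h] at hba
  ext γ
  have hx : ∀ δ : Atom φ.sig Unit, δ.rename (fun _ => FOVar.x) ∈ τ ↔ δ ∈ oneOf U.tree a :=
    fun δ => Set.ext_iff.1 hτ δ
  have hy : ∀ δ : Atom φ.sig Unit, (δ.rename (fun _ => FOVar.x)).rename FOVar.swap ∈ τ ↔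
      δ ∈ oneOf U.tree b := fun δ => Set.ext_iff.1 hτ' δ
  rcases γ with ⟨p, v⟩ | ⟨r, v, v'⟩
  · cases v
    · exact (hx (.inl (p, ()))).symm
    · exact (hy (.inl (p, ()))).symm
  · cases v <;> cases v'
    · exact (hx (.inr (r, (), ()))).symm
    · change (_ ∨ _) ↔ _
      simp [assign, hne, hba, h]
    · change (_ ∨ _) ↔ _
      simp [assign, hne.symm, hba, h]
    · exact (hy (.inr (r, (), ()))).symm

theorem twoOf_tree' {a b : U.Node} {τ : φ.TwoType} {k : ℕ} (h : a.down.1 = (τ, k) :: b.down.1) :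
    twoOf U.tree a b = inv τ := by
  rw [← twoOf_tree U h, inv_twoOf]

theorem adjacent_of_bin {a b : U.Node} (hab : a ≠ b) {r : φ.sig.Bin} (h : U.tree.bin r a b) :
    (∃ τ k, b.down.1 = (τ, k) :: a.down.1) ∨ ∃ τ k, a.down.1 = (τ, k) :: b.down.1 := by
  rcases h with h | ⟨τ, k, h, -⟩ | ⟨τ, k, h, -⟩
  · exact absurd h.1 hab
  · exact Or.inl ⟨τ, k, h⟩
  · exact Or.inr ⟨τ, k, h⟩

theorem not_isForbidden_tree {a b : U.Node} {τ : φ.TwoType} {k : ℕ}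
    (h : b.down.1 = (τ, k) :: a.down.1) : ¬ IsForbidden (twoOf U.tree a b) := by
  rw [twoOf_tree U h]
  exact (IsNode.feasible (h ▸ b.down.2)).2.not_forbidden

theorem twoOf_neighbour (a : U.Node) {x : φ.TwoType × ℕ} (b : U.Node)
    (hb : b.down.1 = neighbour a.down.1 x) : a ≠ b ∧ twoOf U.tree a b = x.1 := by
  unfold neighbour at hb
  split_ifs at hb with h
  · obtain ⟨⟨a, ha⟩⟩ := a
    cases a with
    | nil => exact h.elim
    | cons y a =>
      obtain ⟨τ, k⟩ := y
      obtain ⟨-, rfl⟩ := h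
      refine ⟨?_, twoOf_tree' U (k := k) ?_⟩
      · rintro rfl
        simpa using congrArg List.length hb
      · exact congrArg _ hb.symm
  · refine ⟨?_, twoOf_tree U (k := x.2) hb⟩
    rintro rfl
    simpa using congrArg List.length hb

open Classical in
/-- The messages of an element with star `n` that contain `fᵢ(x,y)`. -/
noncomputable def messages (n : φ.TwoType → ℕ) (i : Fin φ.m) : Finset (φ.TwoType × ℕ) :=
  Finset.univ.biUnion fun τ => if Sends τ i then {τ} ×ˢ Finset.range (n τ) else ∅

theorem mem_messages {n : φ.TwoType → ℕ} {i : Fin φ.m} {x : φ.TwoType × ℕ} :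
    x ∈ messages n i ↔ Sends x.1 i ∧ x.2 < n x.1 := by
  simp only [messages, Finset.mem_biUnion, Finset.mem_univ, true_and]
  constructor
  · rintro ⟨τ, h⟩
    split_ifs at h with hs
    · rw [Finset.mem_product, Finset.mem_singleton, Finset.mem_range] at h
      rw [h.1]
      exact ⟨hs, h.2⟩
    · exact absurd h (Finset.notMem_empty _)
  · rintro ⟨hs, h⟩
    refine ⟨x.1, ?_⟩
    rw [if_pos hs, Finset.mem_product, Finset.mem_singleton, Finset.mem_range]
    exact ⟨rfl, h⟩

theorem card_messages {n : φ.TwoType → ℕ} (hn : E.IsStar pos π φ.C n) (i : Fin φ.m) :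
    (messages n i).card = φ.C i := by
  classical
  rw [messages, Finset.card_biUnion, ← hn.sum, Finset.sum_apply]
  · refine Finset.sum_congr rfl fun τ _ => ?_
    rw [Pi.smul_apply, vecOf]
    split_ifs <;> simp
  · intro τ _ ρ _ hne
    refine Finset.disjoint_left.2 fun x hx hx' => ?_
    beta_reduce at hx hx'
    split_ifs at hx hx'
    · rw [Finset.mem_product, Finset.mem_singleton] at hx hx'
      exact hne (hx.1.symm.trans hx'.1)
    all_goals first
      | exact absurd hx (Finset.notMem_empty _)
      | exact absurd hx' (Finset.notMem_empty _)

/-- The successors of a node are among its children and its parent. A child is reached by the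
message that created it, the parent by the reply numbered `0`, for which `IsNode` creates no child.
Both sides are compared as lists, which avoids node proofs. -/
theorem image_out_tree (a : U.Node) (i : Fin φ.m) :
    (fun b : U.Node => b.down.1) '' {b | U.tree.reduct.bin (φ.f i) a b ∧ a ≠ b} =
      neighbour a.down.1 '' (messages (U.starAt a.down.1) i : Set (φ.TwoType × ℕ)) := by
  ext c
  simp only [Set.mem_image, Finset.mem_coe, mem_messages]
  constructor
  · rintro ⟨b, ⟨hf, hab⟩, rfl⟩
    rcases adjacent_of_bin U hab hf with ⟨τ, k, h⟩ | ⟨τ, k, h⟩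
    · have hτ := twoOf_tree U h
      have hb := b.down.2
      rw [h] at hb
      cases hb with
      | cons _ _ _ _ hk hn =>
        refine ⟨(τ, k), ⟨hτ ▸ hf, hk⟩, ?_⟩
        rw [neighbour, if_neg hn, h]
    · have hs : Sends (inv τ) i := by
        rw [← twoOf_tree' U h]
        exact hf
      refine ⟨(inv τ, 0), ⟨hs, ?_⟩, ?_⟩
      · rw [h]
        -- The slot `0` for the reply exists because the star of the target contains the inverse
        -- type.
        exact Nat.pos_of_ne_zero (U.next_inv τ (IsNode.feasible (h ▸ a.down.2)).2 ⟨i, hs⟩)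
      · rw [h, neighbour, if_pos ⟨⟨i, hs⟩, rfl⟩, List.tail_cons]
  · rintro ⟨x, ⟨hs, hx⟩, rfl⟩
    obtain ⟨hne, h⟩ := twoOf_neighbour U a ⟨⟨_, a.down.2.neighbour hx⟩⟩ rfl
    refine ⟨⟨⟨_, a.down.2.neighbour hx⟩⟩, ⟨?_, hne⟩, rfl⟩
    rw [← h] at hs
    exact hs

theorem tree_isModel : φ.IsModel (U.tree).reduct where
  α a b := by
    -- As the `Cᵢ` are positive, every node sends a message; its type is not forbidden, which forces
    -- `α` at the node.
    have hC : 0 < (messages (U.starAt a.down.1) ⟨0, φ.m_pos⟩).card := by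
      rw [card_messages a.down.2.isStar]
      exact φ.C_pos _
    obtain ⟨x, hx⟩ := Finset.card_pos.1 hC
    have hx := (mem_messages.1 hx).2
    have h := (twoOf_neighbour U a ⟨⟨_, a.down.2.neighbour hx⟩⟩ rfl).2
    have hf : ¬ IsForbidden x.1 :=
      (a.down.2.isStar.feasible x.1 (by omega)).2.not_forbidden
    rw [← h, isForbidden_twoOf_iff] at hf
    refine (Formula.eval_congr ?_ ?_ φ.α_boolean).1 hf.1
    · rintro p v rfl
      rfl
    · rintro r v rfl v' rfl
      rfl
  β h a b hab he := by
    -- The guard confines the conjunct to adjacent nodes, whose 2-type is not forbidden in either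
    -- orientation.
    rcases adjacent_of_bin U hab he with ⟨τ, k, h'⟩ | ⟨τ, k, h'⟩
    · exact ((isForbidden_twoOf_iff _ _ _).1 (not_isForbidden_tree U h')).2.2.1 h he
    · exact ((isForbidden_twoOf_iff _ _ _).1 (not_isForbidden_tree U h')).2.2.2 h he
  f a i := by
    have hinj : Function.Injective fun b : U.Node => b.down.1 :=
      Subtype.val_injective.comp ULift.down_injective
    rw [← hinj.encard_image, image_out_tree, (neighbour_injective _).encard_image,
      Set.encard_coe_eq_coe_finsetCard, card_messages a.down.2.isStar]

end Unravelling

/-- A formula in normal form is satisfiable iff some set of positive variables satisfies all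
constraints. -/
theorem satisfiable_iff_exists_posHolds (E : Enumeration φ) :
    Formula.Satisfiable.{w} φ.toFormula ↔ ∃ pos : E.V → Prop, ∀ c ∈ E.system, c.PosHolds pos := by
  rw [satisfiable_iff]
  constructor
  · rintro ⟨A, _, S, hS⟩
    exact E.exists_posHolds_of_isModel hS
  · rintro ⟨pos, h⟩
    obtain ⟨U⟩ := nonempty_unravelling h
    exact ⟨U.Node, ⟨⟨[], .nil⟩⟩, _, U.tree_isModel⟩

/-- The right-hand side does not involve the universe `w`, so satisfiability does not depend on it.
-/
theorem satisfiable_iff_hornSatisfiable (E : Enumeration φ) :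
    Formula.Satisfiable.{w} φ.toFormula ↔ HornSatisfiable (hornClauses E.system) := by
  rw [satisfiable_iff_exists_posHolds E]
  constructor
  · rintro ⟨pos, h⟩
    refine ⟨fun v => ¬ pos v, (horn_iff_forall_posHolds _ _).2 ?_⟩
    simpa only [not_not] using h
  · rintro ⟨X, h⟩
    exact ⟨_, (horn_iff_forall_posHolds _ _).1 h⟩

end Enumeration

end GC2

theorem mainTheorem4 (σ : GC2.Signature) (φ : GC2.NormalForm σ) (E : GC2.Enumeration φ) :
    (GC2.Formula.Satisfiable.{w} φ.toFormula ↔ GC2.HasSolution E.system Set.univ) ∧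
    (GC2.HasSolution E.system Set.univ ↔ GC2.HasSolution E.system {0, ⊤}) ∧
    (∀ θ : E.V → ℕ∞, (∀ v, θ v ∈ ({0, ⊤} : Set ℕ∞)) →
      (GC2.IsSolution E.system {0, ⊤} θ ↔
        ∀ d ∈ GC2.hornClauses E.system, d.Holds (fun v => θ v = 0))) ∧
    (GC2.HasSolution E.system {0, ⊤} ↔
      GC2.HornSatisfiable (GC2.hornClauses E.system)) := by
  have h₁ := GC2.hasSolution_univ_iff E.proper_of_mem_system
  have h₂ := GC2.hasSolution_iff_hornSatisfiable E.proper_of_mem_system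
  exact ⟨E.satisfiable_iff_hornSatisfiable.trans (h₁.trans h₂).symm, h₁,
    fun _ hθ => GC2.isSolution_iff_horn E.proper_of_mem_system hθ, h₂⟩
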